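/- Let $K$ be a countable (that is, finite or countably infinite) compact Hausdorff space, let $C(K)$ be the Banach space of all continuous functions $f:K\to\mathbb{R}$ with the supremum norm, and let $B_{C(K)}=\{f\in C(K):\ \|f\|\le 1\}$ be its closed unit ball, equipped with the metric $d(f,g)=\|f-g\|$. Let $F:B_{C(K)}\to B_{C(K)}$ be a bijection which is non-expansive, i.e. $\|F(f)-F(g)\|\le\|f-g\|$ for all $f,g\in B_{C(K)}$. Assume that at least one of the following two conditions holds: 1. $F$ maps every extreme point of $B_{C(K)}$ to an extreme point of $B_{C(K)}$; 2. $\inf\{\|F(f)\| :\ f\in C(K),\ \|f\|=1\}>\tfrac12$. Then $F$ is an isometry, i.e. $\|F(f)-F(g)\|=\|f-g\|$ for all $f,g\in B_{C(K)}$. -/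

import Mathlib

open scoped ENNReal

/-- The closed unit ball `B_{C(K)}` of the Banach space `C(K)` of real-valued continuous functions
on `K` (with the supremum norm), as a metric space with the induced metric. -/
abbrev UnitBallC (K : Type*) [TopologicalSpace K] [CompactSpace K] : Type _ :=
  Metric.closedBall (0 : C(K, ℝ)) 1

/-!
The extreme points of the unit ball of `C(K, ℝ)` are the sign functions `sg A` of clopen sets `A`,
and a countable compact Hausdorff space is totally disconnected and scattered, so there are many of
them. Let `F` be a non-expansive bijection of the ball.

* `F 0 = 0`, and `F⁻¹` maps extreme points to extreme points
  (`NonexpansiveBallBijection.abs_eq_one_of_map_eq_sg`), so it induces an injective map `gam` of the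
  clopen sets, which commutes with complements. For `f` in the ball, `‖f - sg B‖ ≤ 1 - t` means
  `t ≤ f * sg B`. As `F` is non-expansive, `t ≤ f * sg (gam A)` implies `t ≤ F f * sg A`; this sign
  test (`NonexpansiveBallBijection.le_mul_sg_of_gam`) carries most of the argument.
* If `F` fixes all extreme points, it is the identity
  (`NonexpansiveBallBijection.eq_self_of_map_sg`). The sign test gives that `F f` lies pointwise
  between `0` and `f`. That `F` is the identity on functions with prescribed values off a clopen
  set `M` is shown by induction on `M`, one point `q` of `M` at a time: first for functions of
  absolute value `1` near `q`, then for those whose absolute value has a strict local maximum at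
  `q`, and these are dense.
* Suppose `gam` comes from an injective map `π : K → K`, that is, `F⁻¹ (sg b)` and `F⁻¹ 1` differ in
  sign exactly on `π ⁻¹' b`. Then `π` is a homeomorphism, and composing `F` with the linear isometry
  given by `π` and the signs of `F⁻¹ 1` yields a bijection fixing all extreme points
  (`NonexpansiveBallBijection.IsPointMap.norm_map_sub`).

It remains to find `π`. If `‖F f‖ > c > 1 / 2` on the sphere, testing with functions with values in
`{±1, ±1 / 2}` shows that `π` exists (`NonexpansiveBallBijection.exists_isPointMap_of_lt_norm`) and
is injective. If `F` preserves extreme points, then `gam` is surjective. In this case changing the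
sign of `sg A` on disjoint clopen sets `b`, `c` changes the sign of its preimage on disjoint sets,
each independent of the other change (`NonexpansiveBallBijection.additive_top`). This holds for
isolated points, and the induction on scattered spaces extends it to all clopen sets. Hence, for
`y : K`, the clopen sets `b` such that `F⁻¹ (sg b)` and `F⁻¹ 1` differ in sign at `y` form an
ultrafilter, which converges to `π y`.
-/

section

open TopologicalSpace Set
open scoped symmDiff

/-! ### Countable compact spaces: clopen sets, isolated points, scattered induction -/

section CountableCompact

variable {K : Type*} [TopologicalSpace K] [CompactSpace K] [T2Space K]

/-- In a zero-dimensional compact space a clopen set fits between a closed set and an open set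
containing it. -/
theorem exists_clopens_between [TotallyDisconnectedSpace K] {S O : Set K} (hS : IsClosed S)
    (hO : IsOpen O) (h : S ⊆ O) : ∃ C : Clopens K, S ⊆ C ∧ (C : Set K) ⊆ O := by
  obtain ⟨C, hC, hSC, hCO⟩ := exists_clopen_of_closed_subset_open hS hO h
  exact ⟨⟨C, hC⟩, hSC, hCO⟩

theorem exists_clopens_mem_subset [TotallyDisconnectedSpace K] {x : K} {O : Set K}
    (hO : IsOpen O) (h : x ∈ O) : ∃ C : Clopens K, x ∈ C ∧ (C : Set K) ⊆ O := by
  obtain ⟨V, hV, hxV, hVO⟩ := compact_exists_isClopen_in_isOpen hO h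
  exact ⟨⟨V, hV⟩, hxV, hVO⟩

/-- Countable compact Hausdorff spaces are scattered: by Baire's theorem, every nonempty closed
subset has a relatively isolated point. -/
theorem exists_isolated_of_isClosed [Countable K] {L : Set K} (hL : IsClosed L)
    (hne : L.Nonempty) : ∃ q ∈ L, ∃ W : Set K, IsOpen W ∧ W ∩ L = {q} := by
  have : CompactSpace L := isCompact_iff_compactSpace.1 hL.isCompact
  have : Nonempty L := hne.to_subtype
  obtain ⟨q, hq⟩ := nonempty_interior_of_iUnion_of_closed (f := fun x : L => ({x} : Set L))
    (fun x => isClosed_singleton) (iUnion_of_singleton L)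
  have hq' : IsOpen ({q} : Set L) := by
    obtain ⟨z, hz⟩ := hq
    have hzq : z = q := mem_singleton_iff.1 (interior_subset hz)
    rw [← interior_eq_iff_isOpen]
    exact interior_subset.antisymm (singleton_subset_iff.2 (hzq ▸ hz))
  obtain ⟨W, hW, hWq⟩ := isOpen_induced_iff.1 hq'
  refine ⟨q, q.2, W, hW, ?_⟩
  ext y
  constructor
  · rintro ⟨hyW, hyL⟩
    have : (⟨y, hyL⟩ : L) ∈ ({q} : Set L) := by rw [← hWq]; exact hyW
    rw [mem_singleton_iff] at this
    rw [mem_singleton_iff, ← this]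
  · intro hy
    rw [mem_singleton_iff] at hy
    have : q ∈ (Subtype.val ⁻¹' W : Set L) := by rw [hWq]; rfl
    rw [hy]
    exact ⟨this, q.2⟩

/-- Isolated points are dense in a countable compact Hausdorff space. -/
theorem exists_isOpen_singleton_mem [Countable K] {C : Clopens K} (hC : C ≠ ⊥) :
    ∃ y ∈ C, IsOpen ({y} : Set K) := by
  have hne : (C : Set K).Nonempty := by
    rw [nonempty_iff_ne_empty]
    intro h
    exact hC (Clopens.ext h)
  obtain ⟨q, hq, W, hW, hWq⟩ := exists_isolated_of_isClosed C.isClosed hne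
  exact ⟨q, hq, hWq ▸ hW.inter C.isOpen⟩

/-- Induction on the clopen subsets of a countable compact space. A property of clopen sets
disjoint from a closed set `L₀` holds for all clopen sets once it passes to any clopen set `U`
from its clopen subsets missing one given point of `U ∩ L₀`. This replaces a transfinite
induction along the Cantor–Bendixson derivatives of `L₀`. -/
theorem clopens_scattered_induction [Countable K] {Q : Clopens K → Prop} {L₀ : Set K}
    (hL₀ : IsClosed L₀) (base : ∀ U : Clopens K, Disjoint (U : Set K) L₀ → Q U)
    (step : ∀ q ∈ L₀, ∀ U : Clopens K, q ∈ U → (∀ V ≤ U, q ∉ V → Q V) → Q U) (U : Clopens K) :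
    Q U := by
  let S : Set (Set K) := {L | IsClosed L ∧ ∀ U : Clopens K, Disjoint (U : Set K) L → Q U}
  obtain ⟨m, hm, hmin⟩ := zorn_superset_nonempty S (by
    intro c hc hchain hne
    refine ⟨⋂₀ c, ⟨isClosed_sInter fun L hL => (hc hL).1, fun U hU => ?_⟩,
      fun s hs => sInter_subset_of_mem hs⟩
    by_contra hQ
    -- otherwise `U` meets every member of the chain, hence its intersection
    have hmeet : ∀ L ∈ c, ((U : Set K) ∩ L).Nonempty := fun L hL => by
      by_contra hemp
      exact hQ ((hc hL).2 U (disjoint_iff_inter_eq_empty.2 (not_nonempty_iff_eq_empty.1 hemp)))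
    have : Nonempty c := hne.to_subtype
    have hne' := IsCompact.nonempty_iInter_of_directed_nonempty_isCompact_isClosed
      (fun L : c => (U : Set K) ∩ L) (by
        intro A B
        rcases hchain.total A.2 B.2 with h | h
        · exact ⟨A, Subset.rfl, inter_subset_inter_right _ h⟩
        · exact ⟨B, inter_subset_inter_right _ h, Subset.rfl⟩)
      (fun L => hmeet L L.2) (fun L => (U.isClosed.inter (hc L.2).1).isCompact)
      (fun L => U.isClosed.inter (hc L.2).1)
    obtain ⟨x, hx⟩ := hne'
    rw [mem_iInter] at hx
    exact disjoint_left.1 hU (hx (Classical.arbitrary c)).1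
      (mem_sInter.2 fun L hL => (hx ⟨L, hL⟩).2)) L₀ ⟨hL₀, base⟩
  rcases m.eq_empty_or_nonempty with rfl | hne
  · exact hmin.1.2 U (disjoint_empty _)
  exfalso
  obtain ⟨q, hqm, W, hW, hWq⟩ := exists_isolated_of_isClosed hmin.1.1 hne
  have hmem : m \ {q} ∈ S := by
    refine ⟨?_, fun U hU => ?_⟩
    · have : m \ {q} = m \ W := by
        ext y
        constructor
        · rintro ⟨hy, hyq⟩
          exact ⟨hy, fun hyW => hyq (hWq ▸ ⟨hyW, hy⟩)⟩
        · rintro ⟨hy, hyW⟩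
          refine ⟨hy, fun hyq => hyW ?_⟩
          have : y ∈ W ∩ m := by rw [hWq]; exact hyq
          exact this.1
      rw [this]
      exact hmin.1.1.sdiff hW
    · have key : ∀ V : Clopens K, V ≤ U → q ∉ V → Q V := fun V hVU hqV =>
        hmin.1.2 V (disjoint_left.2 fun y hyV hym =>
          disjoint_left.1 hU (hVU hyV) ⟨hym, fun h => hqV (by rwa [mem_singleton_iff.1 h] at hyV)⟩)
      by_cases hqU : q ∈ U
      · exact step q (hm hqm) U hqU key
      · exact key U le_rfl hqU
  exact (hmin.2 hmem sdiff_subset hqm).2 rfl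

end CountableCompact

/-! ### Signs of clopen sets and gluing along clopen sets -/

section Glue

variable {K : Type*} [TopologicalSpace K]

open Classical in
/-- The continuous function equal to `f` on the clopen set `N` and to `g` off `N`. -/
noncomputable def glue (N : Clopens K) (f g : C(K, ℝ)) : C(K, ℝ) where
  toFun x := if x ∈ N then f x else g x
  continuous_toFun := by
    refine continuous_if (fun x hx => ?_) f.continuous.continuousOn g.continuous.continuousOn
    have : frontier {a : K | a ∈ N} = ∅ := N.isClopen.frontier_eq
    rw [this] at hx
    exact hx.elim

theorem glue_of_mem {N : Clopens K} {f g : C(K, ℝ)} {x : K} (h : x ∈ N) : glue N f g x = f x :=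
  if_pos h

theorem glue_of_notMem {N : Clopens K} {f g : C(K, ℝ)} {x : K} (h : x ∉ N) :
    glue N f g x = g x :=
  if_neg h

/-- The sign function of a clopen set `A`, equal to `-1` on `A` and to `1` off `A`. These are
exactly the extreme points of the unit ball of `C(K, ℝ)`. -/
noncomputable def sg (A : Clopens K) : C(K, ℝ) := glue A (-1) 1

theorem sg_of_mem {A : Clopens K} {x : K} (h : x ∈ A) : sg A x = -1 := glue_of_mem h

theorem sg_of_notMem {A : Clopens K} {x : K} (h : x ∉ A) : sg A x = 1 := glue_of_notMem h

theorem sg_eq_or (A : Clopens K) (x : K) : sg A x = 1 ∨ sg A x = -1 := by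
  by_cases h : x ∈ A
  · exact Or.inr (sg_of_mem h)
  · exact Or.inl (sg_of_notMem h)

theorem abs_sg (A : Clopens K) (x : K) : |sg A x| = 1 := by
  rcases sg_eq_or A x with h | h <;> simp [h]

theorem sg_mul_self (A : Clopens K) (x : K) : sg A x * sg A x = 1 := by
  rcases sg_eq_or A x with h | h <;> simp [h]

theorem sg_bot (x : K) : sg (⊥ : Clopens K) x = 1 := sg_of_notMem fun h => h

theorem sg_top (x : K) : sg (⊤ : Clopens K) x = -1 := sg_of_mem trivial

theorem sg_compl (A : Clopens K) : sg Aᶜ = -sg A := by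
  ext x
  by_cases h : x ∈ A
  · rw [ContinuousMap.neg_apply, sg_of_mem h,
      sg_of_notMem (fun h' : x ∈ (Aᶜ : Clopens K) => (h' : x ∉ A) h), neg_neg]
  · rw [ContinuousMap.neg_apply, sg_of_notMem h, sg_of_mem (show x ∈ Aᶜ from h)]

theorem sg_injective : Function.Injective (sg : Clopens K → C(K, ℝ)) := by
  intro A B h
  ext x
  have hx := DFunLike.congr_fun h x
  by_cases hA : x ∈ A <;> by_cases hB : x ∈ B
  · exact ⟨fun _ => hB, fun _ => hA⟩
  · rw [sg_of_mem hA, sg_of_notMem hB] at hx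
    norm_num at hx
  · rw [sg_of_notMem hA, sg_of_mem hB] at hx
    norm_num at hx
  · exact ⟨fun h => (hA h).elim, fun h => (hB h).elim⟩

/-- A continuous function with values `±1` is the sign function of a clopen set. -/
theorem exists_eq_sg {f : C(K, ℝ)} (hf : ∀ x, |f x| = 1) : ∃ A : Clopens K, f = sg A := by
  have h1 : {x | f x < 0} = {x | f x ≤ -1} := by
    ext x
    rcases eq_or_eq_neg_of_abs_eq (hf x) with h | h <;> (simp [h]; try norm_num)
  refine ⟨⟨{x | f x < 0}, ⟨?_, isOpen_lt f.continuous continuous_const⟩⟩, ?_⟩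
  · rw [h1]
    exact isClosed_le f.continuous continuous_const
  ext x
  rcases eq_or_eq_neg_of_abs_eq (hf x) with h | h
  · rw [h, sg_of_notMem]
    change ¬ f x < 0
    rw [h]
    norm_num
  · rw [h, sg_of_mem]
    change f x < 0
    rw [h]
    norm_num

theorem mem_symmDiff_clopens {A B : Clopens K} {x : K} :
    x ∈ A ∆ B ↔ ¬ (x ∈ A ↔ x ∈ B) := by
  have : x ∈ A ∆ B ↔ (x ∈ A ∧ x ∉ B) ∨ (x ∈ B ∧ x ∉ A) := Iff.rfl
  rw [this]
  tauto

theorem clopens_ne_bot_of_mem {A : Clopens K} {x : K} (h : x ∈ A) : A ≠ ⊥ := by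
  rintro rfl
  exact h

theorem norm_le_one_iff [CompactSpace K] {f : C(K, ℝ)} : ‖f‖ ≤ 1 ↔ ∀ x, |f x| ≤ 1 :=
  ContinuousMap.norm_le f zero_le_one

theorem norm_sg_le [CompactSpace K] (A : Clopens K) : ‖sg A‖ ≤ 1 :=
  norm_le_one_iff.2 fun x => (abs_sg A x).le

end Glue

/-! ### Non-expansive bijections of the unit ball -/

section Nonexpansive

variable {K : Type*} [TopologicalSpace K] [CompactSpace K]

/-- `F` restricts to a non-expansive bijection of the closed unit ball of `C(K, ℝ)`. Working with
maps of the whole space spares coercions; the values of `F` off the ball are irrelevant. -/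
structure NonexpansiveBallBijection (F : C(K, ℝ) → C(K, ℝ)) : Prop where
  maps : ∀ f, ‖f‖ ≤ 1 → ‖F f‖ ≤ 1
  lip : ∀ f g, ‖f‖ ≤ 1 → ‖g‖ ≤ 1 → ‖F f - F g‖ ≤ ‖f - g‖
  inj : ∀ f g, ‖f‖ ≤ 1 → ‖g‖ ≤ 1 → F f = F g → f = g
  surj : ∀ g, ‖g‖ ≤ 1 → ∃ f, ‖f‖ ≤ 1 ∧ F f = g

namespace NonexpansiveBallBijection

variable {F : C(K, ℝ) → C(K, ℝ)}

theorem abs_le_one {f : C(K, ℝ)} (hf : ‖f‖ ≤ 1) (x : K) : |f x| ≤ 1 := norm_le_one_iff.1 hf x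

theorem abs_map_sub_le (hF : NonexpansiveBallBijection F) {f g : C(K, ℝ)} (hf : ‖f‖ ≤ 1)
    (hg : ‖g‖ ≤ 1) {d : ℝ} (h : ∀ x, |f x - g x| ≤ d) (x : K) : |F f x - F g x| ≤ d := by
  have hd : 0 ≤ d := (abs_nonneg _).trans (h x)
  have h1 : ‖f - g‖ ≤ d := (ContinuousMap.norm_le _ hd).2 h
  exact ((F f - F g).norm_coe_le_norm x).trans ((hF.lip f g hf hg).trans h1)

theorem map_zero (hF : NonexpansiveBallBijection F) : F 0 = 0 := by
  have key : ∀ g : C(K, ℝ), ‖g‖ ≤ 1 → ∀ x, |F 0 x - g x| ≤ 1 := by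
    intro g hg x
    obtain ⟨f, hf, rfl⟩ := hF.surj g hg
    exact hF.abs_map_sub_le (by simp) hf (fun y => by simpa using abs_le_one hf y) x
  ext x
  have h1 := key 1 (norm_le_one_iff.2 fun y => by simp) x
  have h2 := key (-1) (norm_le_one_iff.2 fun y => by simp) x
  simp only [ContinuousMap.one_apply, ContinuousMap.neg_apply, abs_le, ContinuousMap.zero_apply]
    at h1 h2 ⊢
  linarith [h1.1, h1.2, h2.1, h2.2]

/-- The distance of `f` to an extreme point measures how far `f` is from having the same sign, and
`F` does not increase it. -/
theorem le_mul_sg (hF : NonexpansiveBallBijection F) {A B : Clopens K} (hAB : F (sg B) = sg A)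
    {f : C(K, ℝ)} (hf : ‖f‖ ≤ 1) {t : ℝ} (h : ∀ x, t ≤ f x * sg B x) (x : K) :
    t ≤ F f x * sg A x := by
  have h1 : ∀ y, |f y - sg B y| ≤ 1 - t := fun y => by
    have hy := h y
    have hfy := abs_le.1 (abs_le_one hf y)
    rcases sg_eq_or B y with hs | hs <;> rw [hs] at hy ⊢ <;> rw [abs_le] <;>
      constructor <;> linarith [hfy.1, hfy.2]
  have h2 := hF.abs_map_sub_le hf (norm_sg_le B) h1 x
  rw [hAB, abs_le] at h2
  rcases sg_eq_or A x with hs | hs <;> rw [hs] at h2 ⊢ <;> linarith [h2.1, h2.2]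

/-- Preimages of extreme points are extreme: if `F f` is extreme, then `F f / 2` is the only point
at distance at most `1 / 2` from both `0` and `F f`, so there is only one such point for `f`. -/
theorem abs_eq_one_of_map_eq_sg (hF : NonexpansiveBallBijection F) {A : Clopens K}
    {f : C(K, ℝ)} (hf : ‖f‖ ≤ 1) (hA : F f = sg A) (x : K) : |f x| = 1 := by
  have key : ∀ w : C(K, ℝ), (∀ y, |w y| ≤ 1 / 2) → (∀ y, |w y - f y| ≤ 1 / 2) →
      ∀ y, F w y = sg A y / 2 := by
    intro w h1 h2 y
    have hw : ‖w‖ ≤ 1 := norm_le_one_iff.2 fun y => (h1 y).trans (by norm_num)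
    have h3 := hF.abs_map_sub_le hw (g := 0) (by simp) (fun z => by simpa using h1 z) y
    have h4 := hF.abs_map_sub_le hw hf h2 y
    rw [hF.map_zero, abs_le, ContinuousMap.zero_apply] at h3
    rw [hA, abs_le] at h4
    rcases sg_eq_or A y with hs | hs <;> rw [hs] at h4 ⊢ <;>
      linarith [h3.1, h3.2, h4.1, h4.2]
  let w₁ : C(K, ℝ) := ⟨fun y => f y / 2, by fun_prop⟩
  let w₂ : C(K, ℝ) := ⟨fun y => (f y + (1 - |f y|)) / 2, by fun_prop⟩
  have b₁ : ∀ y, |w₁ y| ≤ 1 / 2 := fun y => by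
    have hfy := abs_le.1 (abs_le_one hf y)
    change |f y / 2| ≤ _
    rw [abs_le]
    constructor <;> linarith [hfy.1, hfy.2]
  have b₂ : ∀ y, |w₂ y| ≤ 1 / 2 := fun y => by
    have hfy := abs_le_one hf y
    change |(f y + (1 - |f y|)) / 2| ≤ _
    rw [abs_le]
    constructor <;> linarith [neg_abs_le (f y), le_abs_self (f y)]
  have e : w₁ = w₂ := by
    refine hF.inj _ _ (norm_le_one_iff.2 fun y => (b₁ y).trans (by norm_num))
      (norm_le_one_iff.2 fun y => (b₂ y).trans (by norm_num)) ?_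
    ext y
    rw [key w₁ b₁ ?_ y, key w₂ b₂ ?_ y]
    · intro y
      have hfy := abs_le_one hf y
      change |(f y + (1 - |f y|)) / 2 - f y| ≤ _
      rw [abs_le]
      constructor <;> linarith [neg_abs_le (f y), le_abs_self (f y)]
    · intro y
      have hfy := abs_le.1 (abs_le_one hf y)
      change |f y / 2 - f y| ≤ _
      rw [abs_le]
      constructor <;> linarith [hfy.1, hfy.2]
  have ex : f x / 2 = (f x + (1 - |f x|)) / 2 := DFunLike.congr_fun e x
  linarith

theorem exists_map_sg_eq (hF : NonexpansiveBallBijection F) (A : Clopens K) :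
    ∃ B : Clopens K, F (sg B) = sg A := by
  obtain ⟨f, hf, hA⟩ := hF.surj (sg A) (norm_sg_le A)
  obtain ⟨B, rfl⟩ := exists_eq_sg (hF.abs_eq_one_of_map_eq_sg hf hA)
  exact ⟨B, hA⟩

/-- The map on clopen sets induced by `F⁻¹` on extreme points. -/
noncomputable def gam (hF : NonexpansiveBallBijection F) (A : Clopens K) : Clopens K :=
  (hF.exists_map_sg_eq A).choose

theorem map_sg_gam (hF : NonexpansiveBallBijection F) (A : Clopens K) :
    F (sg (hF.gam A)) = sg A :=
  (hF.exists_map_sg_eq A).choose_spec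

theorem gam_injective (hF : NonexpansiveBallBijection F) : Function.Injective hF.gam := by
  intro A B h
  apply sg_injective
  rw [← hF.map_sg_gam A, h, hF.map_sg_gam B]

theorem le_mul_sg_of_gam (hF : NonexpansiveBallBijection F) (A : Clopens K)
    {f : C(K, ℝ)} (hf : ‖f‖ ≤ 1) {t : ℝ} (h : ∀ x, t ≤ f x * sg (hF.gam A) x) (x : K) :
    t ≤ F f x * sg A x :=
  hF.le_mul_sg (hF.map_sg_gam A) hf h x

/-- The midpoint of the preimages of two opposite extreme points is mapped to `0`. -/
theorem gam_compl (hF : NonexpansiveBallBijection F) (A : Clopens K) :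
    hF.gam Aᶜ = (hF.gam A)ᶜ := by
  set f := sg (hF.gam A) with hf
  set g := sg (hF.gam Aᶜ) with hg
  have hfn : ‖f‖ ≤ 1 := norm_sg_le _
  have hgn : ‖g‖ ≤ 1 := norm_sg_le _
  let m : C(K, ℝ) := ⟨fun x => (f x + g x) / 2, by fun_prop⟩
  have hm : ‖m‖ ≤ 1 := norm_le_one_iff.2 fun x => by
    have h1 := abs_le.1 (abs_le_one hfn x)
    have h2 := abs_le.1 (abs_le_one hgn x)
    change |(f x + g x) / 2| ≤ 1
    rw [abs_le]
    constructor <;> linarith [h1.1, h1.2, h2.1, h2.2]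
  have hd : ∀ x, |m x - f x| ≤ 1 ∧ |m x - g x| ≤ 1 := fun x => by
    have h1 := abs_le.1 (abs_le_one hfn x)
    have h2 := abs_le.1 (abs_le_one hgn x)
    change |(f x + g x) / 2 - f x| ≤ 1 ∧ |(f x + g x) / 2 - g x| ≤ 1
    rw [abs_le, abs_le]
    refine ⟨⟨?_, ?_⟩, ?_, ?_⟩ <;> linarith [h1.1, h1.2, h2.1, h2.2]
  have hFm : F m = F 0 := by
    rw [hF.map_zero]
    ext x
    have h1 := hF.abs_map_sub_le hm hfn (fun y => (hd y).1) x
    have h2 := hF.abs_map_sub_le hm hgn (fun y => (hd y).2) x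
    rw [hf, hF.map_sg_gam, abs_le] at h1
    rw [hg, hF.map_sg_gam, sg_compl, ContinuousMap.neg_apply, abs_le] at h2
    rw [ContinuousMap.zero_apply]
    rcases sg_eq_or A x with hs | hs <;> rw [hs] at h1 h2 <;>
      linarith [h1.1, h1.2, h2.1, h2.2]
  have hm0 := hF.inj _ _ hm (by simp) hFm
  apply sg_injective
  rw [sg_compl, ← hf, ← hg]
  ext x
  have hx : (f x + g x) / 2 = 0 := DFunLike.congr_fun hm0 x
  rw [ContinuousMap.neg_apply]
  linarith

end NonexpansiveBallBijection

end Nonexpansive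

/-! ### Non-expansive bijections fixing all extreme points -/

section FixExtreme

variable {K : Type*} [TopologicalSpace K] [CompactSpace K] [T2Space K]

namespace NonexpansiveBallBijection

variable {F : C(K, ℝ) → C(K, ℝ)}

theorem map_le_max [TotallyDisconnectedSpace K] (hF : NonexpansiveBallBijection F)
    (hfix : ∀ A : Clopens K, F (sg A) = sg A) {f : C(K, ℝ)} (hf : ‖f‖ ≤ 1) (x : K) :
    F f x ≤ max (f x) 0 := by
  refine le_of_forall_pos_le_add fun η hη => ?_
  set a := max (f x) 0 + η with ha
  have ha1 : f x < a := (le_max_left _ _).trans_lt (lt_add_of_pos_right _ hη)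
  have ha2 : 0 < a := (le_max_right _ _).trans_lt (lt_add_of_pos_right _ hη)
  -- a sign function which is `-1` at `x` and almost agrees in sign with `f` elsewhere
  obtain ⟨C, hC1, hC2⟩ := exists_clopens_between
    (isClosed_singleton.union (isClosed_le f.continuous continuous_const) :
      IsClosed ({x} ∪ {y | f y ≤ -a})) (isOpen_lt f.continuous continuous_const :
      IsOpen {y | f y < a}) (by
        rintro y (hy | hy)
        · rw [mem_singleton_iff.1 hy]
          exact ha1
        · exact (show f y ≤ -a from hy).trans_lt (by linarith : -a < a))
  have h := hF.le_mul_sg (hfix C) hf (t := -a) (fun y => by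
    by_cases hy : y ∈ C
    · rw [sg_of_mem hy]
      have : f y < a := hC2 hy
      linarith
    · rw [sg_of_notMem hy]
      have : ¬ f y ≤ -a := fun h => hy (hC1 (Or.inr h))
      linarith) x
  rw [sg_of_mem (hC1 (Or.inl rfl))] at h
  linarith

theorem min_le_map [TotallyDisconnectedSpace K] (hF : NonexpansiveBallBijection F)
    (hfix : ∀ A : Clopens K, F (sg A) = sg A) {f : C(K, ℝ)} (hf : ‖f‖ ≤ 1) (x : K) :
    min (f x) 0 ≤ F f x := by
  refine le_of_forall_pos_le_add fun η hη => ?_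
  set a := -min (f x) 0 + η with ha
  have ha1 : -a < f x := by linarith [min_le_left (f x) 0]
  have ha2 : 0 < a := by linarith [min_le_right (f x) 0]
  obtain ⟨C, hC1, hC2⟩ := exists_clopens_between
    (isClosed_le f.continuous continuous_const : IsClosed {y | f y ≤ -a})
    ((isOpen_lt f.continuous continuous_const).inter isOpen_compl_singleton :
      IsOpen ({y | f y < a} ∩ {x}ᶜ)) (by
        intro y hy
        refine ⟨(show f y ≤ -a from hy).trans_lt (by linarith : -a < a), ?_⟩
        rintro rfl
        exact absurd ha1 (not_lt.2 hy))
  have h := hF.le_mul_sg (hfix C) hf (t := -a) (fun y => by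
    by_cases hy : y ∈ C
    · rw [sg_of_mem hy]
      have : f y < a := (hC2 hy).1
      linarith
    · rw [sg_of_notMem hy]
      have : ¬ f y ≤ -a := fun h => hy (hC1 h)
      linarith) x
  rw [sg_of_notMem (fun hx => (hC2 hx).2 rfl)] at h
  linarith

variable [TotallyDisconnectedSpace K]

theorem map_apply_eq_of_abs_le (hF : NonexpansiveBallBijection F)
    (hfix : ∀ A : Clopens K, F (sg A) = sg A) {f : C(K, ℝ)} (hf : ‖f‖ ≤ 1) {x : K}
    (h : |f x| ≤ |F f x|) : F f x = f x := by
  have h1 := hF.map_le_max hfix hf x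
  have h2 := hF.min_le_map hfix hf x
  rcases le_total 0 (f x) with h0 | h0
  · rw [max_eq_left h0] at h1
    rw [min_eq_right h0] at h2
    rw [abs_of_nonneg h0, abs_of_nonneg h2] at h
    exact h1.antisymm h
  · rw [max_eq_right h0] at h1
    rw [min_eq_left h0] at h2
    rw [abs_of_nonpos h0, abs_of_nonpos h1] at h
    exact le_antisymm (neg_le_neg_iff.1 h) h2

theorem map_apply_eq_of_abs_eq_one (hF : NonexpansiveBallBijection F)
    (hfix : ∀ A : Clopens K, F (sg A) = sg A) {f : C(K, ℝ)} (hf : ‖f‖ ≤ 1) {x : K}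
    (h : |F f x| = 1) : F f x = f x :=
  hF.map_apply_eq_of_abs_le hfix hf (by rw [h]; exact abs_le_one hf x)

/-- The preimages under `F` of the functions of the ball agreeing with `g` off `M` agree with `g`
off `M`. -/
def FixesOff (F : C(K, ℝ) → C(K, ℝ)) (M : Clopens K) (g : C(K, ℝ)) : Prop :=
  ∀ f, ‖f‖ ≤ 1 → (∀ x ∉ M, F f x = g x) → ∀ x ∉ M, f x = g x

/-- The inductive assertion about a clopen set `M`: if `F⁻¹` preserves a class of functions with
prescribed values off `M`, then it is the identity on this class. -/
def Rigid (F : C(K, ℝ) → C(K, ℝ)) (M : Clopens K) : Prop :=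
  ∀ g, FixesOff F M g → ∀ f, ‖f‖ ≤ 1 → (∀ x ∉ M, F f x = g x) → F f = f

section Step

variable {M : Clopens K} {q : K} {g : C(K, ℝ)}

/-- Functions of absolute value `1` near `q` are fixed. -/
theorem fixed_of_abs_eq_one_near (hF : NonexpansiveBallBijection F)
    (hfix : ∀ A : Clopens K, F (sg A) = sg A) (hM : ∀ V ≤ M, q ∉ V → Rigid F V)
    (hg : FixesOff F M g) {u : C(K, ℝ)} (hu : ‖u‖ ≤ 1) (hug : ∀ x ∉ M, u x = g x)
    {V : Clopens K} (hqV : q ∈ V) (hV : ∀ x ∈ V, |u x| = 1) : F u = u := by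
  obtain ⟨f, hf, rfl⟩ := hF.surj u hu
  have hMV : ∀ x, x ∉ M \ V → x ∉ M ∨ x ∈ V := fun x hx => by
    by_contra! h
    exact hx h
  have := hM (M \ V) sdiff_le (fun h => h.2 hqV) (F f) (fun f' hf' h x hx => by
    rcases hMV x hx with hx' | hx'
    · rw [hug x hx']
      refine hg f' hf' (fun y hy => ?_) x hx'
      rw [h y fun h => hy h.1, hug y hy]
    · rw [← h x hx]
      refine (hF.map_apply_eq_of_abs_eq_one hfix hf' ?_).symm
      rw [h x hx, hV x hx']) f hf fun x _ => rfl
  rw [this, this]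

/-- Testing against a fixed function of absolute value `1` wherever `f` is not small. -/
theorem min_abs_le_abs_map (hF : NonexpansiveBallBijection F)
    (hfix : ∀ A : Clopens K, F (sg A) = sg A) (hM : ∀ V ≤ M, q ∉ V → Rigid F V)
    (hq : q ∈ M) (hg : FixesOff F M g) {f : C(K, ℝ)} (hf : ‖f‖ ≤ 1) (hfg : ∀ x ∉ M, f x = g x)
    {x : K} (hx : x ∈ M) : min |f x| |f q| ≤ |F f x| := by
  set m := min |f x| |f q| with hm
  by_cases hm0 : m ≤ 0
  · exact hm0.trans (abs_nonneg _)
  push Not at hm0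
  refine le_of_forall_pos_sub_le fun η hη => ?_
  by_cases hηm : m ≤ η
  · linarith [abs_nonneg (F f x)]
  push Not at hηm
  have hfc : Continuous fun y => |f y| := f.continuous.abs
  obtain ⟨C, hC1, hC2⟩ := exists_clopens_between
    (M.isClosed.inter (isClosed_le continuous_const hfc) : IsClosed (M ∩ {y | m ≤ |f y|}))
    (M.isOpen.inter (isOpen_lt continuous_const hfc) : IsOpen (M ∩ {y | m - η < |f y|}))
    (fun y hy => ⟨hy.1, show m - η < |f y| from
      lt_of_lt_of_le (sub_lt_self _ hη) hy.2⟩)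
  obtain ⟨A, hA1, hA2⟩ := exists_clopens_between
    (isClosed_le f.continuous continuous_const : IsClosed {y | f y ≤ -(m - η)})
    (isOpen_lt f.continuous continuous_const : IsOpen {y | f y < 0})
    (fun y hy => (show f y ≤ -(m - η) from hy).trans_lt (by linarith))
  set u := glue C (sg A) f with hu
  have huC : ∀ y ∈ C, u y = sg A y := fun y hy => glue_of_mem hy
  have huC' : ∀ y ∉ C, u y = f y := fun y hy => glue_of_notMem hy
  have hu1 : ‖u‖ ≤ 1 := norm_le_one_iff.2 fun y => by
    by_cases hy : y ∈ C
    · rw [huC y hy, abs_sg]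
    · rw [huC' y hy]
      exact abs_le_one hf y
  have hFu : F u = u := hF.fixed_of_abs_eq_one_near hfix hM hg hu1
    (fun y hy => by rw [huC' y (fun h => hy (hC2 h).1), hfg y hy])
    (hC1 ⟨hq, show m ≤ |f q| from min_le_right _ _⟩) (fun y hy => by rw [huC y hy, abs_sg])
  have hd : ∀ y, |f y - u y| ≤ 1 - (m - η) := fun y => by
    have hfy := abs_le_one hf y
    by_cases hy : y ∈ C
    · rw [huC y hy]
      have hy2 : m - η < |f y| := (hC2 hy).2
      by_cases hyA : y ∈ A
      · have : f y < 0 := hA2 hyA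
        rw [abs_of_neg this] at hy2 hfy
        rw [sg_of_mem hyA, abs_le]
        constructor <;> linarith
      · have h1 : ¬ f y ≤ -(m - η) := fun h => hyA (hA1 h)
        have h2 : 0 ≤ f y := by
          by_contra h
          push Not at h
          rw [abs_of_neg h] at hy2
          exact h1 (by linarith)
        rw [abs_of_nonneg h2] at hy2 hfy
        rw [sg_of_notMem hyA, abs_le]
        constructor <;> linarith
    · rw [huC' y hy, sub_self, abs_zero]
      linarith [min_le_left |f x| |f q|, abs_le_one hf x]
  have h := hF.abs_map_sub_le hf hu1 hd x
  have hxC : x ∈ C := hC1 ⟨hx, show m ≤ |f x| from min_le_left _ _⟩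
  rw [hFu, huC x hxC] at h
  have h3 := abs_sub_abs_le_abs_sub (sg A x) (F f x)
  rw [abs_sg, abs_sub_comm] at h3
  linarith

/-- A function with a strict local maximum of its absolute value at `q` is fixed. -/
theorem fixed_of_abs_lt_near (hF : NonexpansiveBallBijection F)
    (hfix : ∀ A : Clopens K, F (sg A) = sg A) (hM : ∀ V ≤ M, q ∉ V → Rigid F V)
    (hq : q ∈ M) (hg : FixesOff F M g) {v : C(K, ℝ)} (hv : ‖v‖ ≤ 1) (hvg : ∀ x ∉ M, v x = g x)
    {V : Clopens K} (hVM : V ≤ M) (hqV : q ∈ V) (hV : ∀ x ∈ V, x ≠ q → |v x| < |v q|) :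
    F v = v := by
  obtain ⟨f, hf, rfl⟩ := hF.surj v hv
  have hMV : ∀ x, x ∉ M \ V → x ∉ M ∨ x ∈ V := fun x hx => by
    by_contra! h
    exact hx h
  have := hM (M \ V) sdiff_le (fun h => h.2 hqV) (F f) (fun f' hf' h => by
    have hoff : ∀ x ∉ M, f' x = g x := hg f' hf' (fun y hy => by
      rw [h y fun h => hy h.1, hvg y hy])
    have hmin : ∀ x ∈ M, min |f' x| |f' q| ≤ |F f' x| := fun x hx =>
      hF.min_abs_le_abs_map hfix hM hq hg hf' hoff hx
    have hqq : F f' q = f' q :=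
      hF.map_apply_eq_of_abs_le hfix hf' (by simpa using hmin q hq)
    intro x hx
    rcases hMV x hx with hx' | hx'
    · rw [hvg x hx', hoff x hx']
    · rw [← h x hx]
      by_cases hxq : x = q
      · rw [hxq, hqq]
      · refine (hF.map_apply_eq_of_abs_le hfix hf' ?_).symm
        have h1 := hmin x (hVM hx')
        have h2 : |F f' x| < |f' q| := by
          rw [← hqq, h x hx, h q fun h => h.2 hqV]
          exact hV x hx' hxq
        rcases min_le_iff.1 h1 with h3 | h3
        · exact h3
        · linarith) f hf fun x _ => rfl
  rw [this, this]

/-- Functions with a strict local maximum of the absolute value at `q` are dense. -/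
theorem exists_near_abs_lt [Countable K] (hq : q ∈ M) {v : C(K, ℝ)} (hv : ‖v‖ ≤ 1) {ε : ℝ}
    (hε : 0 < ε) (hε1 : ε ≤ 1) : ∃ u : C(K, ℝ), ‖u‖ ≤ 1 ∧ (∀ x ∉ M, u x = v x) ∧
      (∀ x, |v x - u x| ≤ 3 * ε) ∧
      ∃ V ≤ M, q ∈ V ∧ ∀ x ∈ V, x ≠ q → |u x| < |u q| := by
  obtain ⟨p, hp1, -, -, hp⟩ := exists_continuous_one_zero_of_isCompact_of_isGδ
    (isCompact_singleton (x := q)) (by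
      simpa using (to_countable ({q}ᶜ : Set K)).isGδ_compl) isClosed_empty
    (disjoint_empty _)
  have hpq : p q = 1 := by
    have : q ∈ p ⁻¹' {1} := hp1 ▸ rfl
    exact this
  have hpne : ∀ x, x ≠ q → p x < 1 := fun x hx =>
    lt_of_le_of_ne (hp x).2 fun h => hx (by
      have : x ∈ p ⁻¹' {1} := h
      rwa [← hp1] at this)
  obtain ⟨V, hqV, hV⟩ := exists_clopens_mem_subset (x := q)
    (O := M ∩ ({x | |v x - v q| < ε} ∩ {x | 1 - ε < p x}))
    (M.isOpen.inter ((isOpen_lt (by fun_prop) continuous_const).inter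
      (isOpen_lt continuous_const p.continuous)))
    ⟨hq, by simpa using hε, by simp [hpq, hε]⟩
  set a := max |v q| ε with ha
  have ha0 : 0 < a := lt_max_of_lt_right hε
  have ha1 : a ≤ 1 := max_le (abs_le_one hv q) hε1
  obtain ⟨s, hs, hsa⟩ : ∃ s : ℝ, |s| = 1 ∧ |v q - s * a| ≤ ε := by
    rcases le_total 0 (v q) with h | h
    · refine ⟨1, abs_one, ?_⟩
      rw [ha, abs_of_nonneg h, abs_le]
      constructor
      · rcases max_cases (v q) ε with h' | h' <;> linarith
      · linarith [le_max_left (v q) ε]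
    · refine ⟨-1, by simp, ?_⟩
      rw [ha, abs_of_nonpos h, abs_le]
      constructor
      · linarith [le_max_left (-v q) ε]
      · rcases max_cases (-v q) ε with h' | h' <;> linarith
  let b : C(K, ℝ) := ⟨fun x => s * (a * ((1 + p x) / 2)), by fun_prop⟩
  have hb : ∀ x, |b x| = a * ((1 + p x) / 2) := fun x => by
    change |s * (a * ((1 + p x) / 2))| = _
    rw [abs_mul, hs, one_mul, abs_of_nonneg]
    have := (hp x).1
    positivity
  refine ⟨glue V b v, norm_le_one_iff.2 fun x => ?_, fun x hx => ?_, fun x => ?_, V,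
    fun x hx => (hV hx).1, hqV, fun x hx hxq => ?_⟩
  · by_cases hx : x ∈ V
    · rw [glue_of_mem hx, hb]
      have := (hp x).2
      have := (hp x).1
      nlinarith
    · rw [glue_of_notMem hx]
      exact abs_le_one hv x
  · exact glue_of_notMem fun h => hx (hV h).1
  · by_cases hx : x ∈ V
    · rw [glue_of_mem hx]
      have h1 : |v x - v q| < ε := (hV hx).2.1
      have h2 : 1 - ε < p x := (hV hx).2.2
      have h3 := (hp x).2
      have h4 : |s * a - b x| ≤ ε := by
        have : s * a - b x = s * (a * ((1 - p x) / 2)) := by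
          change s * a - s * (a * ((1 + p x) / 2)) = _
          ring
        rw [this, abs_mul, hs, one_mul, abs_of_nonneg (mul_nonneg ha0.le (by linarith))]
        nlinarith
      have h5 : v x - b x = (v x - v q) + (v q - s * a) + (s * a - b x) := by ring
      rw [h5]
      linarith [abs_add_three (v x - v q) (v q - s * a) (s * a - b x)]
    · rw [glue_of_notMem hx, sub_self, abs_zero]
      positivity
  · rw [glue_of_mem hx, glue_of_mem hqV, hb, hb, hpq]
    have := hpne x hxq
    nlinarith

end Step

/-- A non-expansive bijection fixing all extreme points is the identity. -/
theorem eq_self_of_map_sg [Countable K] (hF : NonexpansiveBallBijection F)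
    (hfix : ∀ A : Clopens K, F (sg A) = sg A) {f : C(K, ℝ)} (hf : ‖f‖ ≤ 1) : F f = f := by
  have hrigid : ∀ M : Clopens K, Rigid F M := by
    refine clopens_scattered_induction isClosed_univ (fun U hU => ?_) (fun q _ M hq hM => ?_)
    · rintro g hg f hf hfg
      have hU' : ∀ x, x ∉ U := fun x hx => disjoint_left.1 hU hx trivial
      ext x
      rw [hfg x (hU' x), hg f hf hfg x (hU' x)]
    · intro g hg f hf hfg
      have hv : ‖F f‖ ≤ 1 := hF.maps f hf
      suffices h : F (F f) = F f from hF.inj _ _ hv hf h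
      ext x
      refine eq_of_abs_sub_le_all fun ε hε => ?_
      have hδ : 0 < min (ε / 6) 1 := lt_min (by linarith) one_pos
      obtain ⟨u, hu, huv, hd, V, hVM, hqV, hV⟩ :=
        exists_near_abs_lt hq hv hδ (min_le_right _ _)
      have hFu : F u = u := hF.fixed_of_abs_lt_near hfix hM hq hg hu
        (fun x hx => by rw [huv x hx, hfg x hx]) hVM hqV hV
      have h1 := hF.abs_map_sub_le hv hu hd x
      rw [hFu] at h1
      have h2 := hd x
      rw [abs_sub_comm] at h2
      have h3 := abs_sub_le (F (F f) x) (u x) (F f x)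
      linarith [min_le_left (ε / 6) 1]
  exact hrigid ⊤ f (fun f' _ _ x hx => (hx trivial).elim) f hf fun x hx => (hx trivial).elim

end NonexpansiveBallBijection

end FixExtreme

/-! ### The map of `K` inducing `F⁻¹` on extreme points -/

section PointMap

variable {K : Type*} [TopologicalSpace K] [CompactSpace K]

namespace NonexpansiveBallBijection

variable {F : C(K, ℝ) → C(K, ℝ)} {π : K → K}

/-- The map `π` induces the action of `F⁻¹` on extreme points: passing from the extreme point `1` to
`sg b` changes the sign of the preimage exactly on `π ⁻¹' b`. -/
def IsPointMap (hF : NonexpansiveBallBijection F) (π : K → K) : Prop :=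
  ∀ b y, y ∈ hF.gam ⊥ ∆ hF.gam b ↔ π y ∈ b

/-- Since `F⁻¹` is odd on extreme points, one implication determines the other. -/
theorem exists_isPointMap (hF : NonexpansiveBallBijection F)
    (h : ∀ y, ∃ x, ∀ b : Clopens K, x ∈ b → y ∈ hF.gam ⊥ ∆ hF.gam b) :
    ∃ π, hF.IsPointMap π := by
  choose π hπ using h
  refine ⟨π, fun b y => ⟨fun hy => ?_, hπ y b⟩⟩
  by_contra hb
  have h1 := hπ y bᶜ hb
  rw [mem_symmDiff_clopens] at h1 hy
  rw [hF.gam_compl] at h1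
  have : y ∈ (hF.gam b)ᶜ ↔ y ∉ hF.gam b := Iff.rfl
  tauto

theorem IsPointMap.sg_gam {hF : NonexpansiveBallBijection F} (hπ : hF.IsPointMap π)
    (A : Clopens K) (y : K) : sg (hF.gam A) y = sg (hF.gam ⊥) y * sg A (π y) := by
  have h := hπ A y
  rw [mem_symmDiff_clopens] at h
  by_cases h1 : y ∈ hF.gam ⊥ <;> by_cases h2 : y ∈ hF.gam A
  · rw [sg_of_mem h1, sg_of_mem h2, sg_of_notMem fun h3 => h.2 h3 ⟨fun _ => h2, fun _ => h1⟩]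
    norm_num
  · rw [sg_of_mem h1, sg_of_notMem h2, sg_of_mem (h.1 fun h3 => h2 (h3.1 h1))]
    norm_num
  · rw [sg_of_notMem h1, sg_of_mem h2, sg_of_mem (h.1 fun h3 => h1 (h3.2 h2))]
    norm_num
  · rw [sg_of_notMem h1, sg_of_notMem h2, sg_of_notMem fun h3 => h.2 h3
      ⟨fun h' => (h1 h').elim, fun h' => (h2 h').elim⟩]
    norm_num

/-- The sign test of `le_mul_sg` in the coordinates given by `π`. -/
theorem IsPointMap.le_mul_sg {hF : NonexpansiveBallBijection F} (hπ : hF.IsPointMap π)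
    (A : Clopens K) {g : C(K, ℝ)} (hg : ‖g‖ ≤ 1) {t : ℝ} (h : ∀ x, t ≤ g x * sg A (π x)) (x : K) :
    t ≤ F (sg (hF.gam ⊥) * g) x * sg A x := by
  refine hF.le_mul_sg_of_gam A ?_ (fun y => ?_) x
  · refine norm_le_one_iff.2 fun y => ?_
    rw [ContinuousMap.mul_apply, abs_mul, abs_sg, one_mul]
    exact abs_le_one hg y
  · rw [hπ.sg_gam, ContinuousMap.mul_apply]
    have := sg_mul_self (hF.gam ⊥) y
    calc t ≤ g y * sg A (π y) := h y
      _ = (sg (hF.gam ⊥) y * sg (hF.gam ⊥) y) * (g y * sg A (π y)) := by rw [this, one_mul]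
      _ = _ := by ring

variable [T2Space K] [TotallyDisconnectedSpace K]

theorem IsPointMap.continuous {hF : NonexpansiveBallBijection F} (hπ : hF.IsPointMap π) :
    Continuous π := by
  refine isTopologicalBasis_isClopen.continuous_iff.2 fun s hs => ?_
  have : π ⁻¹' s = (hF.gam ⊥ ∆ hF.gam ⟨s, hs⟩ : Clopens K) := by
    ext y
    exact (hπ ⟨s, hs⟩ y).symm
  rw [this]
  exact Clopens.isOpen _

theorem IsPointMap.surjective {hF : NonexpansiveBallBijection F} (hπ : hF.IsPointMap π) :
    Function.Surjective π := by
  by_contra h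
  obtain ⟨p, hp⟩ := not_forall.1 h
  -- a clopen neighbourhood of `p` missing the range would have the same image as `⊥`
  obtain ⟨b, hpb, hb⟩ := exists_clopens_mem_subset
    (isCompact_range hπ.continuous).isClosed.isOpen_compl hp
  have : (⊥ : Clopens K) = b := hF.gam_injective (by
    ext y
    by_contra hy
    exact hb ((hπ b y).1 (mem_symmDiff_clopens.2 hy)) (mem_range_self y))
  rw [← this] at hpb
  exact hpb

/-- If `π` is injective, then `π` and the signs of `F⁻¹ 1` define a linear isometry; composed with
it, `F` fixes all extreme points and hence is the identity. -/
theorem IsPointMap.norm_map_sub [Countable K] {hF : NonexpansiveBallBijection F}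
    (hπ : hF.IsPointMap π) (hinj : Function.Injective π) {f g : C(K, ℝ)} (hf : ‖f‖ ≤ 1)
    (hg : ‖g‖ ≤ 1) : ‖F f - F g‖ = ‖f - g‖ := by
  let e : K ≃ₜ K := Continuous.homeoOfEquivCompactToT2
    (f := Equiv.ofBijective π ⟨hinj, hπ.surjective⟩) hπ.continuous
  have he : ∀ x, e x = π x := fun x => rfl
  set θ := sg (hF.gam ⊥) with hθ
  have hθθ : ∀ x, θ x * θ x = 1 := sg_mul_self _
  let T : C(K, ℝ) → C(K, ℝ) := fun f => θ * f.comp ⟨e, e.continuous⟩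
  let T' : C(K, ℝ) → C(K, ℝ) := fun f => (θ * f).comp ⟨e.symm, e.symm.continuous⟩
  have hT : ∀ f x, T f x = θ x * f (e x) := fun f x => rfl
  have hT' : ∀ f x, T' f x = θ (e.symm x) * f (e.symm x) := fun f x => rfl
  have hTT' : ∀ f, T (T' f) = f := fun f => by
    ext x
    rw [hT, hT', e.symm_apply_apply, ← mul_assoc, hθθ, one_mul]
  have hnorm : ∀ f g, ‖T f - T g‖ = ‖f - g‖ := fun f g => by
    apply le_antisymm
    · refine (ContinuousMap.norm_le _ (norm_nonneg _)).2 fun x => ?_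
      rw [ContinuousMap.sub_apply, hT, hT, ← mul_sub, norm_mul]
      have : ‖θ x‖ = 1 := abs_sg _ x
      rw [this, one_mul]
      exact (f - g).norm_coe_le_norm (e x)
    · refine (ContinuousMap.norm_le _ (norm_nonneg _)).2 fun x => ?_
      have h1 := (T f - T g).norm_coe_le_norm (e.symm x)
      rw [ContinuousMap.sub_apply, hT, hT, ← mul_sub, norm_mul, e.apply_symm_apply] at h1
      have : ‖θ (e.symm x)‖ = 1 := abs_sg _ _
      rwa [this, one_mul] at h1
  have hT0 : T 0 = 0 := by
    ext x
    simp [hT]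
  have hnorm0 : ∀ f, ‖T f‖ = ‖f‖ := fun f => by
    have := hnorm f 0
    rwa [hT0, sub_zero, sub_zero] at this
  have hFT : NonexpansiveBallBijection (fun f => F (T f)) :=
    { maps := fun f hf => hF.maps _ ((hnorm0 f).trans_le hf)
      lip := fun f g hf hg => (hF.lip _ _ ((hnorm0 f).trans_le hf)
        ((hnorm0 g).trans_le hg)).trans_eq (hnorm f g)
      inj := fun f g hf hg h => by
        have h1 := hF.inj _ _ ((hnorm0 f).trans_le hf) ((hnorm0 g).trans_le hg) h
        rw [← sub_eq_zero, ← norm_eq_zero, ← hnorm, h1, sub_self, norm_zero]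
      surj := fun g hg => by
        obtain ⟨f, hf, rfl⟩ := hF.surj g hg
        refine ⟨T' f, ?_, congrArg F (hTT' f)⟩
        rw [← hnorm0, hTT']
        exact hf }
  have hfix : ∀ A : Clopens K, F (T (sg A)) = sg A := fun A => by
    have : T (sg A) = sg (hF.gam A) := by
      ext x
      rw [hT, he, hπ.sg_gam A]
    rw [this, hF.map_sg_gam]
  have hid : ∀ f, ‖f‖ ≤ 1 → F (T f) = f := fun f hf => hFT.eq_self_of_map_sg hfix hf
  have hnf : ∀ f, ‖f‖ ≤ 1 → ‖T' f‖ ≤ 1 := fun f hf => by rwa [← hnorm0, hTT']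
  conv_lhs => rw [← hTT' f, ← hTT' g]
  rw [hid _ (hnf f hf), hid _ (hnf g hg), ← hnorm, hTT', hTT']

end NonexpansiveBallBijection

end PointMap

/-! ### Non-expansive bijections that do not shrink the sphere too much -/

section LargeOnSphere

variable {K : Type*} [TopologicalSpace K] [CompactSpace K]

namespace NonexpansiveBallBijection

variable {F : C(K, ℝ) → C(K, ℝ)} {c : ℝ}

theorem exists_lt_abs_map {f : C(K, ℝ)} (hf : ‖f‖ ≤ 1) {x : K} (hx : |f x| = 1)
    (hc : ∀ f, ‖f‖ = 1 → c < ‖F f‖) (hc0 : 0 ≤ c) : ∃ r, c < |F f r| := by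
  by_contra! h
  have h1 : ‖F f‖ ≤ c := (ContinuousMap.norm_le _ hc0).2 h
  have h2 : ‖f‖ = 1 := le_antisymm hf (by
    rw [← hx]
    exact f.norm_coe_le_norm x)
  exact (hc f h2).not_ge h1

/-- If the point `y` had no image under `π`, then finitely many clopen sets `b` with
`y ∉ gam ⊥ ∆ gam b` would cover `K`. The complement `N` of these symmetric differences is a
neighbourhood of `y`, and `F` maps the function with the signs of `F⁻¹ 1` and absolute value
`1` on `N`, `1 / 2` off `N`, to a function of norm at most `1 / 2`. -/
theorem exists_isPointMap_of_lt_norm (hF : NonexpansiveBallBijection F)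
    (hc : ∀ f, ‖f‖ = 1 → c < ‖F f‖) (hc2 : 1 / 2 ≤ c) : ∃ π, hF.IsPointMap π := by
  refine hF.exists_isPointMap fun y => ?_
  by_contra! h
  choose b hxb hyb using h
  obtain ⟨t, ht⟩ := CompactSpace.elim_nhds_subcover (fun x => (b x : Set K))
    (fun x => (b x).isOpen.mem_nhds (hxb x))
  set N : Clopens K := (t.sup fun x => hF.gam ⊥ ∆ hF.gam (b x))ᶜ with hN
  have hNt : ∀ x ∈ t, ∀ z ∈ N, z ∉ hF.gam ⊥ ∆ hF.gam (b x) := fun x hx z hz hz' =>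
    (show z ∉ t.sup fun x => hF.gam ⊥ ∆ hF.gam (b x) from hz)
      (Finset.le_sup (f := fun x => hF.gam ⊥ ∆ hF.gam (b x)) hx hz')
  have hyN : y ∈ N := by
    change y ∉ ((t.sup fun x => hF.gam ⊥ ∆ hF.gam (b x) : Clopens K) : Set K)
    rw [Clopens.coe_finset_sup]
    simp only [mem_iUnion, not_exists]
    exact fun x _ => hyb x
  let half : C(K, ℝ) := ContinuousMap.const K (1 / 2)
  set g := glue N 1 half with hg
  have hgN : ∀ z ∈ N, g z = 1 := fun z hz => glue_of_mem hz
  have hgN' : ∀ z ∉ N, g z = 1 / 2 := fun z hz => glue_of_notMem hz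
  set f := sg (hF.gam ⊥) * g with hf
  have hfz : ∀ z, f z = sg (hF.gam ⊥) z * g z := fun z => rfl
  have hgle : ∀ z, 1 / 2 ≤ g z ∧ g z ≤ 1 := fun z => by
    by_cases hz : z ∈ N
    · rw [hgN z hz]
      norm_num
    · rw [hgN' z hz]
      norm_num
  have hf1 : ‖f‖ ≤ 1 := norm_le_one_iff.2 fun z => by
    rw [hfz, abs_mul, abs_sg, one_mul, abs_le]
    constructor <;> linarith [(hgle z).1, (hgle z).2]
  obtain ⟨r, hr⟩ := exists_lt_abs_map hf1 (x := y) (by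
    rw [hfz, abs_mul, abs_sg, hgN y hyN, one_mul, abs_one]) hc (by linarith)
  have hlow := hF.le_mul_sg_of_gam ⊥ hf1 (t := 1 / 2) (fun z => by
    rw [hfz, mul_right_comm, sg_mul_self, one_mul]
    exact (hgle z).1) r
  rw [sg_bot, mul_one] at hlow
  obtain ⟨x, hxt, hrx⟩ : ∃ x ∈ t, r ∈ b x := by
    have : r ∈ ⋃ x ∈ t, (b x : Set K) := ht ▸ trivial
    simpa using this
  have hup := hF.le_mul_sg_of_gam (b x) hf1 (t := -(1 / 2)) (fun z => by
    rw [hfz]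
    by_cases hz : z ∈ N
    · have h1 := hNt x hxt z hz
      rw [mem_symmDiff_clopens, not_not] at h1
      have h2 : sg (hF.gam (b x)) z = sg (hF.gam ⊥) z := by
        by_cases h3 : z ∈ hF.gam ⊥
        · rw [sg_of_mem h3, sg_of_mem (h1.1 h3)]
        · rw [sg_of_notMem h3, sg_of_notMem fun h4 => h3 (h1.2 h4)]
      rw [h2, mul_right_comm, sg_mul_self, one_mul, hgN z hz]
      norm_num
    · rw [hgN' z hz]
      rcases sg_eq_or (hF.gam ⊥) z with h1 | h1 <;>
        rcases sg_eq_or (hF.gam (b x)) z with h2 | h2 <;> rw [h1, h2] <;> norm_num) r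
  rw [sg_of_mem hrx] at hup
  rw [abs_of_nonneg (by linarith)] at hr
  linarith

variable [T2Space K] [TotallyDisconnectedSpace K]

/-- Suppose `π y₁ = π y₂ = p`, and let `N` be a clopen set separating `y₁` from `y₂`. Up to signs,
let `f` be the function `1` on `N`, `-1/2` off `N`. For every neighbourhood `P` of `p`,
changing values over `P` or off `P` gives functions within `1 / 2` of `f` whose images
have a value above `c`, respectively below `-c`, over `P`. So `F f p` would be both positive
and negative. -/
theorem IsPointMap.injective_of_lt_norm {hF : NonexpansiveBallBijection F} {π : K → K}
    (hπ : hF.IsPointMap π) (hc : ∀ f, ‖f‖ = 1 → c < ‖F f‖) (hc2 : 1 / 2 < c) :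
    Function.Injective π := by
  intro y₁ y₂ hy
  by_contra hne
  obtain ⟨N, hyN, hN⟩ := exists_clopens_mem_subset
    (isOpen_compl_singleton : IsOpen ({y₂}ᶜ : Set K)) (x := y₁) hne
  have hyN₂ : y₂ ∉ N := fun h => hN h rfl
  let k : ℝ → C(K, ℝ) := fun a => ContinuousMap.const K a
  have hk : ∀ a x, k a x = a := fun _ _ => rfl
  set θ := sg (hF.gam ⊥) with hθ
  set g := glue N 1 (k (-1 / 2)) with hg
  have hgN : ∀ z ∈ N, g z = 1 := fun z hz => glue_of_mem hz
  have hgN' : ∀ z ∉ N, g z = -1 / 2 := fun z hz => glue_of_notMem hz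
  have hball : ∀ g : C(K, ℝ), (∀ z, |g z| ≤ 1) → ‖g‖ ≤ 1 ∧ ‖θ * g‖ ≤ 1 := fun g hg =>
    ⟨norm_le_one_iff.2 hg, norm_le_one_iff.2 fun z => by
      rw [ContinuousMap.mul_apply, hθ, abs_mul, abs_sg, one_mul]
      exact hg z⟩
  have habs : ∀ (g : C(K, ℝ)) z, |(θ * g) z| = |g z| := fun g z => by
    rw [ContinuousMap.mul_apply, hθ, abs_mul, abs_sg, one_mul]
  have hg1 : ∀ z, |g z| ≤ 1 := fun z => by
    by_cases hz : z ∈ N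
    · rw [hgN z hz, abs_one]
    · rw [hgN' z hz, abs_le]
      norm_num
  have hpre : ∀ P : Clopens K, ∃ P' : Clopens K, ∀ z, z ∈ P' ↔ π z ∈ P := fun P =>
    ⟨⟨π ⁻¹' P, P.isClopen.preimage hπ.continuous⟩, fun z => Iff.rfl⟩
  have hnear : ∀ (g' : C(K, ℝ)), (∀ z, |g' z| ≤ 1) → (∀ z, |g z - g' z| ≤ 1 / 2) →
      ∀ r, |F (θ * g) r - F (θ * g') r| ≤ 1 / 2 := fun g' hg' h r =>
    hF.abs_map_sub_le (hball g hg1).2 (hball g' hg').2 (fun z => by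
      rw [ContinuousMap.mul_apply, ContinuousMap.mul_apply, ← mul_sub, hθ, abs_mul, abs_sg,
        one_mul]
      exact h z) r
  have hpos : ∀ P : Clopens K, π y₁ ∈ P → ∃ r ∈ P, c - 1 / 2 < F (θ * g) r := fun P hP => by
    obtain ⟨P', hP'⟩ := hpre P
    set u := glue P' g (glue N (k (1 / 2)) (k (-1 / 2))) with hu
    have hu₁ : ∀ z, π z ∈ P → z ∈ N → u z = 1 := fun z h1 h2 => by
      rw [hu, glue_of_mem ((hP' z).2 h1), hgN z h2]
    have hu₂ : ∀ z, π z ∉ P → z ∈ N → u z = 1 / 2 := fun z h1 h2 => by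
      rw [hu, glue_of_notMem (fun h => h1 ((hP' z).1 h)), glue_of_mem h2, hk]
    have hu₃ : ∀ z, z ∉ N → u z = -1 / 2 := fun z h2 => by
      by_cases h1 : π z ∈ P
      · rw [hu, glue_of_mem ((hP' z).2 h1), hgN' z h2]
      · rw [hu, glue_of_notMem (fun h => h1 ((hP' z).1 h)), glue_of_notMem h2, hk]
    have hall : ∀ z, |u z| ≤ 1 ∧ |g z - u z| ≤ 1 / 2 ∧ -(1 / 2) ≤ u z ∧
        (π z ∉ P → u z ≤ 1 / 2) := fun z => by
      by_cases h2 : z ∈ N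
      · by_cases h1 : π z ∈ P
        · rw [hu₁ z h1 h2, hgN z h2]
          norm_num [h1]
        · rw [hu₂ z h1 h2, hgN z h2]
          norm_num [abs_le]
      · rw [hu₃ z h2, hgN' z h2]
        norm_num [abs_le]
    have hu1 := hball u fun z => (hall z).1
    obtain ⟨r, hr⟩ := exists_lt_abs_map hu1.2 (x := y₁) (by
      rw [habs, hu₁ y₁ hP hyN, abs_one]) hc (by linarith)
    have hlow := hπ.le_mul_sg ⊥ hu1.1 (t := -(1 / 2)) (fun z => by
      rw [sg_bot, mul_one]
      exact (hall z).2.2.1) r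
    rw [sg_bot, mul_one] at hlow
    have hrc : c < F (θ * u) r := by
      rcases lt_abs.1 hr with h | h
      · exact h
      · linarith
    have hrP : r ∈ P := by
      by_contra hrP
      have hup := hπ.le_mul_sg Pᶜ hu1.1 (t := -(1 / 2)) (fun z => by
        by_cases hz : π z ∈ P
        · rw [sg_of_notMem (show π z ∉ Pᶜ from fun h => h hz), mul_one]
          exact (hall z).2.2.1
        · rw [sg_of_mem (show π z ∈ Pᶜ from hz)]
          linarith [(hall z).2.2.2 hz]) r
      rw [sg_of_mem (show r ∈ Pᶜ from hrP)] at hup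
      linarith
    have := (abs_le.1 (hnear u (fun z => (hall z).1) (fun z => (hall z).2.1) r)).1
    exact ⟨r, hrP, by linarith⟩
  have hneg : ∀ P : Clopens K, π y₁ ∈ P → ∃ r ∈ P, F (θ * g) r < -(c - 1 / 2) := fun P hP => by
    obtain ⟨P', hP'⟩ := hpre P
    set u := glue N (k (1 / 2)) (glue P' (-1) (k (-1 / 2))) with hu
    have hu₁ : ∀ z, z ∈ N → u z = 1 / 2 := fun z h2 => by
      rw [hu, glue_of_mem h2, hk]
    have hu₂ : ∀ z, π z ∈ P → z ∉ N → u z = -1 := fun z h1 h2 => by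
      rw [hu, glue_of_notMem h2, glue_of_mem ((hP' z).2 h1)]
      rfl
    have hu₃ : ∀ z, π z ∉ P → z ∉ N → u z = -1 / 2 := fun z h1 h2 => by
      rw [hu, glue_of_notMem h2, glue_of_notMem (fun h => h1 ((hP' z).1 h)), hk]
    have hall : ∀ z, |u z| ≤ 1 ∧ |g z - u z| ≤ 1 / 2 ∧ u z ≤ 1 / 2 ∧
        (π z ∉ P → -(1 / 2) ≤ u z) := fun z => by
      by_cases h2 : z ∈ N
      · rw [hu₁ z h2, hgN z h2]
        norm_num [abs_le]
      · by_cases h1 : π z ∈ P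
        · rw [hu₂ z h1 h2, hgN' z h2]
          norm_num [h1, abs_le]
        · rw [hu₃ z h1 h2, hgN' z h2]
          norm_num [abs_le]
    have hu1 := hball u fun z => (hall z).1
    obtain ⟨r, hr⟩ := exists_lt_abs_map hu1.2 (x := y₂) (by
      rw [habs, hu₂ y₂ (hy ▸ hP) hyN₂, abs_neg, abs_one]) hc (by linarith)
    have hup := hπ.le_mul_sg ⊤ hu1.1 (t := -(1 / 2)) (fun z => by
      rw [sg_top]
      linarith [(hall z).2.2.1]) r
    rw [sg_top] at hup
    have hrc : F (θ * u) r < -c := by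
      rcases lt_abs.1 hr with h | h
      · linarith
      · linarith
    have hrP : r ∈ P := by
      by_contra hrP
      have hlow := hπ.le_mul_sg P hu1.1 (t := -(1 / 2)) (fun z => by
        by_cases hz : π z ∈ P
        · rw [sg_of_mem hz]
          linarith [(hall z).2.2.1]
        · rw [sg_of_notMem hz, mul_one]
          exact (hall z).2.2.2 hz) r
      rw [sg_of_notMem hrP] at hlow
      linarith
    have := (abs_le.1 (hnear u (fun z => (hall z).1) (fun z => (hall z).2.1) r)).2
    exact ⟨r, hrP, by linarith⟩
  rcases lt_or_ge (F (θ * g) (π y₁)) (c - 1 / 2) with h | h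
  · obtain ⟨P, hP, hPs⟩ := exists_clopens_mem_subset
      (isOpen_lt (F (θ * g)).continuous continuous_const) h
    obtain ⟨r, hr, hr'⟩ := hpos P hP
    have : F (θ * g) r < c - 1 / 2 := hPs hr
    linarith
  · obtain ⟨P, hP, hPs⟩ := exists_clopens_mem_subset (x := π y₁)
      (isOpen_lt continuous_const (F (θ * g)).continuous)
      (show -(c - 1 / 2) < F (θ * g) (π y₁) by linarith)
    obtain ⟨r, hr, hr'⟩ := hneg P hP
    have : -(c - 1 / 2) < F (θ * g) r := hPs hr
    linarith

end NonexpansiveBallBijection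

end LargeOnSphere

/-! ### Sign changes of preimages of extreme points -/

section Flips

variable {K : Type*} [TopologicalSpace K]

theorem clopens_disjoint_iff {A B : Clopens K} : Disjoint A B ↔ ∀ x ∈ A, x ∉ B := by
  rw [← Clopens.coe_disjoint, disjoint_left]
  rfl

theorem mem_sup_clopens {A B : Clopens K} {x : K} : x ∈ A ⊔ B ↔ x ∈ A ∨ x ∈ B := Iff.rfl

theorem mem_inf_clopens {A B : Clopens K} {x : K} : x ∈ A ⊓ B ↔ x ∈ A ∧ x ∈ B := Iff.rfl

theorem mem_sdiff_clopens {A B : Clopens K} {x : K} : x ∈ A \ B ↔ x ∈ A ∧ x ∉ B := Iff.rfl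

theorem clopens_ext_isolated [CompactSpace K] [T2Space K] [Countable K] {A B : Clopens K}
    (h : ∀ y, IsOpen ({y} : Set K) → (y ∈ A ↔ y ∈ B)) : A = B := by
  by_contra hne
  obtain ⟨y, hy, hyo⟩ := exists_isOpen_singleton_mem
    (show A ∆ B ≠ ⊥ from fun h' => hne (symmDiff_eq_bot.1 h'))
  exact mem_symmDiff_clopens.1 hy (h y hyo)

/-- An isolated point as a clopen set. -/
def isolatedPoint [T1Space K] (x : K) (hx : IsOpen ({x} : Set K)) : Clopens K :=
  ⟨{x}, isClosed_singleton, hx⟩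

theorem mem_isolatedPoint [T1Space K] {x y : K} {hx : IsOpen ({x} : Set K)} :
    y ∈ isolatedPoint x hx ↔ y = x := Iff.rfl

/-- Induction on clopen sets all of whose points are isolated; these are finite. -/
theorem clopens_isolated_induction [CompactSpace K] [T1Space K] {P : Clopens K → Prop}
    (bot : P ⊥) (insert : ∀ b x hx, x ∉ b → (∀ y ∈ b, IsOpen ({y} : Set K)) → P b →
      P (b ∆ isolatedPoint x hx))
    (b : Clopens K) (hb : ∀ x ∈ b, IsOpen ({x} : Set K)) : P b := by
  classical
  have key : ∀ t : Finset K, ∀ b : Clopens K, (∀ x ∈ b, x ∈ t) →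
      (∀ x ∈ b, IsOpen ({x} : Set K)) → P b := by
    intro t
    induction t using Finset.induction_on with
    | empty =>
      intro b hbt _
      have : b = ⊥ := by
        ext x
        exact ⟨fun h => absurd (hbt x h) (Finset.notMem_empty x), fun h => h.elim⟩
      rwa [this]
    | insert a t _ ih =>
      intro b hbt hb
      by_cases ha : a ∈ b
      · have hbe : b = (b \ isolatedPoint a (hb a ha)) ∆ isolatedPoint a (hb a ha) := by
          refine SetLike.ext fun x => ?_
          rw [mem_symmDiff_clopens, mem_sdiff_clopens, mem_isolatedPoint]
          have : x = a → x ∈ b := fun h => h ▸ ha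
          tauto
        rw [hbe]
        refine insert _ _ _ (fun h => h.2 rfl) (fun y hy => hb y hy.1) (ih _ (fun x hx => ?_)
          fun x hx => hb x hx.1)
        exact (Finset.mem_insert.1 (hbt x hx.1)).resolve_left hx.2
      · refine ih b (fun x hx => (Finset.mem_insert.1 (hbt x hx)).resolve_left ?_) hb
        rintro rfl
        exact ha hx
  obtain ⟨t, ht⟩ := b.isClosed.isCompact.elim_finite_subcover
    (fun x : b => ({(x : K)} : Set K)) (fun x => hb x x.2)
    (fun x hx => mem_iUnion.2 ⟨⟨x, hx⟩, rfl⟩)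
  refine key (t.image Subtype.val) b (fun x hx => ?_) hb
  obtain ⟨y, hy, hxy⟩ := mem_iUnion₂.1 (ht hx)
  exact Finset.mem_image.2 ⟨y, hy, hxy.symm⟩

theorem exists_neg_le_mul_sg [CompactSpace K] [T2Space K]
    [TotallyDisconnectedSpace K] (w : C(K, ℝ)) {ε : ℝ}
    (hε : 0 < ε) : ∃ C : Clopens K, ∀ x, -ε ≤ w x * sg C x := by
  obtain ⟨C, hC1, hC2⟩ := exists_clopens_between
    (isClosed_le w.continuous continuous_const : IsClosed {x | w x ≤ -ε})
    (isOpen_lt w.continuous continuous_const : IsOpen {x | w x < 0})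
    (fun x hx => (show w x ≤ -ε from hx).trans_lt (by linarith))
  refine ⟨C, fun x => ?_⟩
  by_cases hx : x ∈ C
  · rw [sg_of_mem hx]
    have : w x < 0 := hC2 hx
    linarith
  · rw [sg_of_notMem hx]
    have : ¬ w x ≤ -ε := fun h => hx (hC1 h)
    linarith

theorem neg_le_mul_sg_symmDiff {w : C(K, ℝ)} {ε : ℝ} {C c : Clopens K}
    (hC : ∀ x, -ε ≤ w x * sg C x) (hc : ∀ x ∈ c, |w x| ≤ ε) (x : K) :
    -ε ≤ w x * sg (C ∆ c) x := by
  by_cases hx : x ∈ c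
  · have h := abs_le.1 (hc x hx)
    rcases sg_eq_or (C ∆ c) x with h' | h' <;> rw [h'] <;> linarith [h.1, h.2]
  · have : sg (C ∆ c) x = sg C x := by
      by_cases h : x ∈ C
      · rw [sg_of_mem h, sg_of_mem (mem_symmDiff_clopens.2 fun h' => hx (h'.1 h))]
      · rw [sg_of_notMem h, sg_of_notMem fun h' => mem_symmDiff_clopens.1 h'
          ⟨fun h1 => (h h1).elim, fun h1 => (hx h1).elim⟩]
    rw [this]
    exact hC x

theorem mem_iff_of_neg_lt_sg_mul_sg {A B : Clopens K} {x : K} {a t : ℝ}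
    (h : -t ≤ (a * sg A x) * sg B x) (ha : t < a) : x ∈ A ↔ x ∈ B := by
  by_cases h1 : x ∈ A <;> by_cases h2 : x ∈ B
  · exact ⟨fun _ => h2, fun _ => h1⟩
  · rw [sg_of_mem h1, sg_of_notMem h2] at h
    linarith
  · rw [sg_of_notMem h1, sg_of_mem h2] at h
    linarith
  · exact ⟨fun h => (h1 h).elim, fun h => (h2 h).elim⟩

namespace NonexpansiveBallBijection

variable [CompactSpace K] {F : C(K, ℝ) → C(K, ℝ)}

/-- The set on which the preimage of `sg A` changes sign when the signs of `sg A` are changed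
on `b`. -/
noncomputable def flip (hF : NonexpansiveBallBijection F) (A b : Clopens K) : Clopens K :=
  hF.gam A ∆ hF.gam (A ∆ b)

theorem mem_flip (hF : NonexpansiveBallBijection F) {A b : Clopens K} {y : K} :
    y ∈ hF.flip A b ↔ ¬ (y ∈ hF.gam A ↔ y ∈ hF.gam (A ∆ b)) := mem_symmDiff_clopens

theorem flip_symmDiff (hF : NonexpansiveBallBijection F) (A b c : Clopens K) :
    hF.flip A (b ∆ c) = hF.flip A b ∆ hF.flip (A ∆ b) c := by
  refine SetLike.ext fun y => ?_
  rw [mem_symmDiff_clopens, mem_flip, mem_flip, mem_flip, symmDiff_assoc]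
  tauto

theorem mem_flip_symmDiff (hF : NonexpansiveBallBijection F) {A b c : Clopens K} {y : K} :
    y ∈ hF.flip A (b ∆ c) ↔ ¬ (y ∈ hF.flip A b ↔ y ∈ hF.flip (A ∆ b) c) := by
  rw [flip_symmDiff, mem_symmDiff_clopens]

/-- Both orders of performing two sign changes give the same result. -/
theorem flip_comm (hF : NonexpansiveBallBijection F) (A b c : Clopens K) (y : K) :
    (y ∈ hF.flip A b ↔ y ∈ hF.flip (A ∆ b) c) ↔ (y ∈ hF.flip A c ↔ y ∈ hF.flip (A ∆ c) b) := by
  rw [← not_iff_not, ← mem_flip_symmDiff, ← mem_flip_symmDiff, symmDiff_comm]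

/-- Sign changes on disjoint clopen subsets of `U` are mapped to independent, disjoint sign
changes. -/
def Additive (hF : NonexpansiveBallBijection F) (U : Clopens K) : Prop :=
  ∀ A b c, b ≤ U → c ≤ U → Disjoint b c →
    hF.flip (A ∆ b) c = hF.flip A c ∧ Disjoint (hF.flip A b) (hF.flip A c)

variable [T2Space K] [TotallyDisconnectedSpace K]

/-- If all extreme points are images of extreme points under `F⁻¹`, then `F` maps functions without
zeros to functions without zeros. -/
theorem exists_eq_zero (hF : NonexpansiveBallBijection F) (hs : Function.Surjective hF.gam)
    {w : C(K, ℝ)} (hw : ‖w‖ ≤ 1) {q : K} (hq : F w q = 0) : ∃ z, w z = 0 := by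
  obtain ⟨z, -, hz⟩ := isCompact_univ.exists_isMinOn (f := fun x => |w x|) ⟨q, trivial⟩
    w.continuous.abs.continuousOn
  refine ⟨z, ?_⟩
  by_contra h
  have hε : 0 < |w z| := abs_pos.2 h
  obtain ⟨C, hC⟩ := exists_neg_le_mul_sg w (half_pos hε)
  obtain ⟨A, rfl⟩ := hs C
  have h1 := hF.le_mul_sg_of_gam A hw (t := |w z|) (fun x => by
    have h2 : |w z| ≤ |w x| := hz (mem_univ x)
    have h3 := hC x
    have h4 : |w x * sg (hF.gam A) x| = |w x| := by rw [abs_mul, abs_sg, mul_one]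
    rcases abs_choice (w x * sg (hF.gam A) x) with h5 | h5 <;> rw [h5] at h4 <;> linarith) q
  rw [hq, zero_mul] at h1
  linarith

/-- Changing the sign at an isolated point changes the preimage at just one, isolated, point. The
function that vanishes at `x` and agrees with `sg A` elsewhere is compatible with two sign
functions only, so its preimage is compatible with at most two, and it has a zero. -/
theorem flip_isolatedPoint (hF : NonexpansiveBallBijection F)
    (hs : Function.Surjective hF.gam) (A : Clopens K) (x : K) (hx : IsOpen ({x} : Set K)) :
    ∃ z, ∀ y, y ∈ hF.flip A (isolatedPoint x hx) ↔ y = z := by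
  set p := isolatedPoint x hx with hp
  set v := glue p 0 (sg A) with hv
  have hvx : v x = 0 := glue_of_mem (mem_isolatedPoint.2 rfl)
  have hvy : ∀ y, y ≠ x → v y = sg A y := fun y hy => glue_of_notMem hy
  have hv1 : ‖v‖ ≤ 1 := norm_le_one_iff.2 fun y => by
    by_cases hy : y = x
    · rw [hy, hvx, abs_zero]
      exact zero_le_one
    · rw [hvy y hy, abs_sg]
  obtain ⟨w, hw, hwv⟩ := hF.surj v hv1
  obtain ⟨z, hz⟩ := hF.exists_eq_zero hs hw (q := x) (by rw [hwv, hvx])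
  have htwo : ∀ B, (∀ y, -(1 / 2) ≤ w y * sg (hF.gam B) y) → B = A ∨ B = A ∆ p := by
    intro B hB
    have h1 : ∀ y, y ≠ x → (y ∈ A ↔ y ∈ B) := fun y hy => by
      have h := hF.le_mul_sg_of_gam B hw hB y
      rw [hwv, hvy y hy, ← one_mul (sg A y)] at h
      exact mem_iff_of_neg_lt_sg_mul_sg h (by norm_num)
    by_cases h2 : x ∈ A ↔ x ∈ B
    · left
      ext y
      by_cases hy : y = x
      · rw [hy]
        exact h2.symm
      · exact (h1 y hy).symm
    · right
      ext y
      change y ∈ B ↔ y ∈ A ∆ p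
      rw [mem_symmDiff_clopens, hp, mem_isolatedPoint]
      by_cases hy : y = x
      · rw [hy]
        tauto
      · have := h1 y hy
        tauto
  have hall : ∀ c : Clopens K, z ∈ c → (∀ y ∈ c, |w y| ≤ 1 / 2) → c = hF.flip A p := by
    intro c hzc hc
    obtain ⟨C, hC⟩ := exists_neg_le_mul_sg w (ε := 1 / 2) (by norm_num)
    obtain ⟨B₁, hB₁⟩ := hs C
    obtain ⟨B₂, hB₂⟩ := hs (C ∆ c)
    have h1 := htwo B₁ (by rw [hB₁]; exact hC)
    have h2 := htwo B₂ (by rw [hB₂]; exact neg_le_mul_sg_symmDiff hC hc)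
    have hne : B₁ ≠ B₂ := by
      rintro rfl
      rw [hB₁, eq_comm, symmDiff_eq_left] at hB₂
      exact clopens_ne_bot_of_mem hzc hB₂
    have hcc : c = hF.gam B₁ ∆ hF.gam B₂ := by
      rw [hB₁, hB₂, symmDiff_symmDiff_cancel_left]
    rcases h1 with rfl | rfl <;> rcases h2 with rfl | rfl
    · exact absurd rfl hne
    · exact hcc
    · rw [hcc, symmDiff_comm]
      rfl
    · exact absurd rfl hne
  have hsmall : IsOpen {y | |w y| < 1 / 2} := isOpen_lt w.continuous.abs continuous_const
  have hzs : z ∈ {y | |w y| < 1 / 2} := by simp [hz]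
  have hzc : z ∈ hF.flip A p := by
    obtain ⟨c, hzc, hc⟩ := exists_clopens_mem_subset hsmall hzs
    rw [← hall c hzc fun y hy => le_of_lt (hc hy)]
    exact hzc
  refine ⟨z, fun y => ⟨fun hy => ?_, fun hy => hy ▸ hzc⟩⟩
  by_contra hyz
  obtain ⟨c, hzc, hc⟩ := exists_clopens_mem_subset
    (hsmall.inter (isOpen_compl_singleton : IsOpen ({y}ᶜ : Set K))) ⟨hzs, Ne.symm hyz⟩
  rw [← hall c hzc fun y hy => le_of_lt (hc hy).1] at hy
  exact (hc hy).2 rfl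

theorem flip_isolatedPoint_symmDiff (hF : NonexpansiveBallBijection F)
    (hs : Function.Surjective hF.gam) (A : Clopens K) {x x' : K} (hx : IsOpen ({x} : Set K))
    (hx' : IsOpen ({x'} : Set K)) (hne : x ≠ x') :
    hF.flip (A ∆ isolatedPoint x hx) (isolatedPoint x' hx') = hF.flip A (isolatedPoint x' hx') ∧
      Disjoint (hF.flip A (isolatedPoint x hx)) (hF.flip A (isolatedPoint x' hx')) := by
  set p := isolatedPoint x hx
  set p' := isolatedPoint x' hx'
  have hpp : p ≠ p' := fun h => hne (by
    have : x ∈ p' := h ▸ mem_isolatedPoint.2 rfl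
    exact this)
  obtain ⟨z₁, h₁⟩ := hF.flip_isolatedPoint hs A x hx
  obtain ⟨z₂, h₂⟩ := hF.flip_isolatedPoint hs A x' hx'
  obtain ⟨z₃, h₃⟩ := hF.flip_isolatedPoint hs (A ∆ p) x' hx'
  obtain ⟨z₄, h₄⟩ := hF.flip_isolatedPoint hs (A ∆ p') x hx
  -- `F⁻¹` maps the four corners of a square to distinct points
  have h12 : z₁ ≠ z₂ := by
    rintro rfl
    have h : hF.flip A p = hF.flip A p' := by
      ext y
      exact (h₁ y).trans (h₂ y).symm
    exact hpp (symmDiff_right_injective A (hF.gam_injective (symmDiff_right_injective _ h)))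
  have h13 : z₁ ≠ z₃ := by
    rintro rfl
    have h : hF.flip A (p ∆ p') = ⊥ := by
      rw [flip_symmDiff, symmDiff_eq_bot]
      ext y
      exact (h₁ y).trans (h₃ y).symm
    have h' := hF.gam_injective (symmDiff_eq_bot.1 h)
    rw [eq_comm, symmDiff_eq_left, symmDiff_eq_bot] at h'
    exact hpp h'
  have hc := hF.flip_comm A p p' z₁
  rw [h₁, h₃, h₂, h₄] at hc
  have h14 : z₁ = z₄ := by tauto
  have hc' := hF.flip_comm A p p' z₂
  rw [h₁, h₃, h₂, h₄, ← h14] at hc'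
  have h23 : z₂ = z₃ := by
    have := h12.symm
    tauto
  refine ⟨?_, clopens_disjoint_iff.2 fun y hy hy' => h12 (((h₁ y).1 hy).symm.trans ((h₂ y).1 hy'))⟩
  ext y
  exact (h₃ y).trans (h23 ▸ (h₂ y).symm)

/-- Finite sets of isolated points are additive. -/
theorem additive_of_isolated (hF : NonexpansiveBallBijection F)
    (hs : Function.Surjective hF.gam) {U : Clopens K} (hU : ∀ x ∈ U, IsOpen ({x} : Set K)) :
    hF.Additive U := by
  have one : ∀ b : Clopens K, (∀ x ∈ b, IsOpen ({x} : Set K)) →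
      ∀ x (hx : IsOpen ({x} : Set K)), x ∉ b → ∀ A,
      hF.flip (A ∆ b) (isolatedPoint x hx) = hF.flip A (isolatedPoint x hx) ∧
        Disjoint (hF.flip A b) (hF.flip A (isolatedPoint x hx)) := by
    refine clopens_isolated_induction ?_ ?_
    · intro x hx _ A
      rw [symmDiff_bot]
      refine ⟨rfl, ?_⟩
      have : hF.flip A ⊥ = ⊥ := by rw [flip, symmDiff_bot, symmDiff_self]
      rw [this]
      exact disjoint_bot_left
    · intro b x' hx' hx'b _ ih x hx hxb A
      rw [mem_symmDiff_clopens, mem_isolatedPoint] at hxb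
      have hxx' : x' ≠ x := by
        rintro rfl
        tauto
      have hxb' : x ∉ b := by
        have := hxx'.symm
        tauto
      have h1 := ih x hx hxb' A
      have h2 := ih x' hx' hx'b A
      have h3 := hF.flip_isolatedPoint_symmDiff hs (A ∆ b) hx' hx hxx'
      have h4 := hF.flip_isolatedPoint_symmDiff hs A hx' hx hxx'
      refine ⟨by rw [← symmDiff_assoc, h3.1, h1.1], ?_⟩
      rw [flip_symmDiff, h2.1]
      exact (h1.2.sup_left h4.2).mono_left symmDiff_le_sup
  have two : ∀ c : Clopens K, (∀ x ∈ c, IsOpen ({x} : Set K)) →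
      ∀ b : Clopens K, (∀ x ∈ b, IsOpen ({x} : Set K)) → Disjoint b c → ∀ A,
      hF.flip (A ∆ b) c = hF.flip A c ∧ Disjoint (hF.flip A b) (hF.flip A c) := by
    refine clopens_isolated_induction ?_ ?_
    · intro b _ _ A
      have : ∀ A, hF.flip A ⊥ = ⊥ := fun A => by rw [flip, symmDiff_bot, symmDiff_self]
      rw [this, this]
      exact ⟨rfl, disjoint_bot_right⟩
    · intro c x hx hxc hc ih b hb hbc A
      rw [clopens_disjoint_iff] at hbc
      have hbc' : Disjoint b c := clopens_disjoint_iff.2 fun y hy hyc => hbc y hy (by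
        rw [mem_symmDiff_clopens, mem_isolatedPoint]
        intro h
        exact hxc ((h.1 hyc) ▸ hyc))
      have hxb : x ∉ b := fun h => hbc x h (by
        rw [mem_symmDiff_clopens, mem_isolatedPoint]
        tauto)
      have h1 := ih b hb hbc' A
      have h2 := one c hc x hx hxc A
      have h3 := one (b ∆ c) (fun y hy => by
        rw [mem_symmDiff_clopens] at hy
        by_cases hyb : y ∈ b
        · exact hb y hyb
        · exact hc y (by tauto)) x hx (by rw [mem_symmDiff_clopens]; tauto) A
      have h4 := one b hb x hx hxb A
      rw [flip_symmDiff, flip_symmDiff, h1.1, h2.1, symmDiff_assoc, h3.1]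
      exact ⟨rfl, (h1.2.sup_right h4.2).mono_right symmDiff_le_sup⟩
  intro A b c hb hc hbc
  exact two c (fun x hx => hU x (hc hx)) b (fun x hx => hU x (hb hx)) hbc A

end NonexpansiveBallBijection

end Flips

/-! ### Additivity of sign changes -/

section AdditiveStep

variable {K : Type*} [TopologicalSpace K] [CompactSpace K] [T2Space K]

namespace NonexpansiveBallBijection

variable {F : C(K, ℝ) → C(K, ℝ)} {U : Clopens K} {q : K}

omit [T2Space K] in
/-- Among the small sign changes near `q` that avoid `q`, none affects a given point `z`, since two
disjoint ones cannot both do so. -/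
theorem exists_notMem_flip_of_notMem (hF : NonexpansiveBallBijection F) (hqU : q ∈ U)
    (hU : ∀ V ≤ U, q ∉ V → hF.Additive V) (A : Clopens K) (z : K) :
    ∃ V ≤ U, q ∈ V ∧ ∀ b ≤ V, q ∉ b → z ∉ hF.flip A b := by
  by_contra! h
  obtain ⟨b, hbU, hqb, hzb⟩ := h U le_rfl hqU
  obtain ⟨c, hc, hqc, hzc⟩ := h (U \ b) sdiff_le ⟨hqU, hqb⟩
  have hbc : Disjoint b c := (disjoint_sdiff_self_left.mono_left hc).symm
  have := (hU (b ⊔ c) (sup_le hbU (hc.trans sdiff_le)) (fun h => h.elim hqb hqc) A b c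
    le_sup_left le_sup_right hbc).2
  exact clopens_disjoint_iff.1 this z hzb hzc

omit [T2Space K] in
/-- The sign at `z` of the preimage of `sg (A ∆ b)`, for `b` near `q`, depends only on whether `b`
contains `q`. -/
theorem exists_mem_gam_iff (hF : NonexpansiveBallBijection F) (hqU : q ∈ U)
    (hU : ∀ V ≤ U, q ∉ V → hF.Additive V) (A : Clopens K) (z : K) :
    ∃ V ≤ U, q ∈ V ∧ ∀ b ≤ V, ∀ c ≤ V, (q ∈ b ↔ q ∈ c) →
      (z ∈ hF.gam (A ∆ b) ↔ z ∈ hF.gam (A ∆ c)) := by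
  obtain ⟨V₁, hV₁, hq₁, h₁⟩ := hF.exists_notMem_flip_of_notMem hqU hU A z
  obtain ⟨V₂, hV₂, hq₂, h₂⟩ := hF.exists_notMem_flip_of_notMem hqU hU (A ∆ U) z
  have hout : ∀ b ≤ V₁ ⊓ V₂, q ∉ b → (z ∈ hF.gam A ↔ z ∈ hF.gam (A ∆ b)) := fun b hb hqb =>
    not_not.1 fun h => h₁ b (hb.trans inf_le_left) hqb (hF.mem_flip.2 h)
  have hin : ∀ b ≤ V₁ ⊓ V₂, q ∈ b →
      (z ∈ hF.gam (A ∆ (V₁ ⊓ V₂)) ↔ z ∈ hF.gam (A ∆ b)) := fun b hb hqb => by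
    set V := V₁ ⊓ V₂ with hV
    have hVU : V ≤ U := inf_le_left.trans hV₁
    have hqV : q ∈ V := ⟨hq₁, hq₂⟩
    have e₁ : (A ∆ U) ∆ (U \ V) = A ∆ V := by
      refine SetLike.ext fun x => ?_
      simp only [mem_symmDiff_clopens, mem_sdiff_clopens]
      have : x ∈ V → x ∈ U := fun h => hVU h
      tauto
    have e₂ : (A ∆ V) ∆ (V \ b) = A ∆ b := by
      refine SetLike.ext fun x => ?_
      simp only [mem_symmDiff_clopens, mem_sdiff_clopens]
      have : x ∈ b → x ∈ V := fun h => hb h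
      tauto
    have h := (hU ((U \ V) ⊔ (V \ b)) (sup_le sdiff_le (sdiff_le.trans hVU))
      (fun h => h.elim (fun h => h.2 hqV) fun h => h.2 hqb) (A ∆ U) (U \ V) (V \ b)
      le_sup_left le_sup_right (disjoint_sdiff_self_left.mono_right sdiff_le)).1
    have hz := h₂ (V \ b) (sdiff_le.trans inf_le_right) (fun h => h.2 hqb)
    rw [← h, e₁, mem_flip, e₂] at hz
    exact not_not.1 hz
  refine ⟨V₁ ⊓ V₂, inf_le_left.trans hV₁, ⟨hq₁, hq₂⟩, fun b hb c hc hbc => ?_⟩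
  by_cases hqb : q ∈ b
  · exact (hin b hb hqb).symm.trans (hin c hc (hbc.1 hqb))
  · exact (hout b hb hqb).symm.trans (hout c hc fun h => hqb (hbc.2 h))

variable [Countable K]

/-- At a non-isolated point `q`, small sign changes near `q` do not affect a given isolated point
`y`. Otherwise let `F w` vanish exactly at `q` and have the signs of `sg A` elsewhere. Sign
functions compatible with `w` come from sign functions near `sg A`; this forces `w` to vanish
exactly at `y`. Then `w` is compatible with two sign functions, which differ at `y`, whereas
`F w` is compatible with only one. -/
theorem exists_notMem_flip (hF : NonexpansiveBallBijection F)
    (hs : Function.Surjective hF.gam) (hq : ¬ IsOpen ({q} : Set K)) (hqU : q ∈ U)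
    (hU : ∀ V ≤ U, q ∉ V → hF.Additive V) (A : Clopens K) (y : K) (hy : IsOpen ({y} : Set K)) :
    ∃ V ≤ U, q ∈ V ∧ ∀ b ≤ V, q ∈ b → y ∉ hF.flip A b := by
  obtain ⟨V₀, hV₀, hqV₀, hdep⟩ := hF.exists_mem_gam_iff hqU hU A y
  by_cases hκ : y ∈ hF.gam A ↔ y ∈ hF.gam (A ∆ V₀)
  · refine ⟨V₀, hV₀, hqV₀, fun b hb hqb => ?_⟩
    rw [mem_flip, not_not, hκ]
    exact hdep V₀ le_rfl b hb ⟨fun _ => hqb, fun _ => hqV₀⟩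
  exfalso
  obtain ⟨p, hp1, -, -, hp⟩ := exists_continuous_one_zero_of_isCompact_of_isGδ
    (isCompact_singleton (x := q)) (by
      simpa using (to_countable ({q}ᶜ : Set K)).isGδ_compl) isClosed_empty
    (disjoint_empty _)
  have hpq : p q = 1 := by
    have : q ∈ p ⁻¹' {1} := hp1 ▸ rfl
    exact this
  have hpne : ∀ x, x ≠ q → 0 < 1 - p x := fun x hx => by
    have : p x ≠ 1 := fun h => hx (by
      have : x ∈ p ⁻¹' {1} := h
      rwa [← hp1] at this)
    have := lt_of_le_of_ne (hp x).2 this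
    linarith
  let v : C(K, ℝ) := ⟨fun x => (1 - p x) * sg A x, by fun_prop⟩
  have hv : ∀ x, v x = (1 - p x) * sg A x := fun _ => rfl
  have hv1 : ‖v‖ ≤ 1 := norm_le_one_iff.2 fun x => by
    rw [hv, abs_mul, abs_sg, mul_one, abs_le]
    constructor <;> linarith [(hp x).1, (hp x).2]
  obtain ⟨w, hw, hwv⟩ := hF.surj v hv1
  -- `w` has a zero, and `y` is its only one
  obtain ⟨z₀, hz₀⟩ := hF.exists_eq_zero hs hw (q := q) (by rw [hwv, hv, hpq]; simp)
  have hzero : ∀ z, w z = 0 → z = y := by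
    intro z hz
    by_contra hzy
    obtain ⟨V₁, hV₁, hqV₁, hdep₁⟩ := hF.exists_mem_gam_iff hqU hU A z
    obtain ⟨ε, hε, hεV⟩ : ∃ ε > 0, ∀ x ∉ V₀ ⊓ V₁, ε < 1 - p x := by
      rcases ((V₀ ⊓ V₁)ᶜ : Set K).eq_empty_or_nonempty with h | h
      · refine ⟨1, one_pos, fun x hx => ?_⟩
        have : x ∈ ((V₀ ⊓ V₁)ᶜ : Set K) := hx
        rw [h] at this
        exact this.elim
      · obtain ⟨x₀, hx₀, hmin⟩ := (V₀ ⊓ V₁).isOpen.isClosed_compl.isCompact.exists_isMinOn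
          (f := fun x => 1 - p x) h (by fun_prop)
        have hne : x₀ ≠ q := by
          rintro rfl
          exact hx₀ ⟨hqV₀, hqV₁⟩
        refine ⟨(1 - p x₀) / 2, half_pos (hpne x₀ hne), fun x hx => ?_⟩
        have h1 : 1 - p x₀ ≤ 1 - p x := hmin hx
        have := hpne x₀ hne
        linarith
    -- two sign functions almost compatible with `w`, which differ at `z` but not at `y`
    obtain ⟨c, hzc, hc⟩ := exists_clopens_mem_subset
      ((isOpen_lt w.continuous.abs continuous_const : IsOpen {x | |w x| < ε}).inter
        (isOpen_compl_singleton : IsOpen ({y}ᶜ : Set K))) (x := z) ⟨by simpa [hz] using hε, hzy⟩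
    obtain ⟨C, hC⟩ := exists_neg_le_mul_sg w hε
    have hnear : ∀ B, (∀ x, -ε ≤ w x * sg (hF.gam B) x) → A ∆ B ≤ V₀ ⊓ V₁ := by
      intro B hB x hx
      by_contra hxV
      have h := hF.le_mul_sg_of_gam B hw hB x
      rw [hwv, hv] at h
      exact mem_symmDiff_clopens.1 hx (mem_iff_of_neg_lt_sg_mul_sg h (hεV x hxV))
    obtain ⟨B₁, hB₁⟩ := hs C
    obtain ⟨B₂, hB₂⟩ := hs (C ∆ c)
    have hn₁ := hnear B₁ (by rw [hB₁]; exact hC)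
    have hn₂ := hnear B₂ (by
      rw [hB₂]
      exact neg_le_mul_sg_symmDiff hC fun x hx => le_of_lt (hc hx).1)
    have hyc : y ∈ hF.gam B₁ ↔ y ∈ hF.gam B₂ := by
      have : y ∉ c := fun h => (hc h).2 rfl
      rw [hB₁, hB₂, mem_symmDiff_clopens]
      tauto
    have hzc' : ¬ (z ∈ hF.gam B₁ ↔ z ∈ hF.gam B₂) := by
      rw [hB₁, hB₂, mem_symmDiff_clopens]
      tauto
    have e₁ : A ∆ (A ∆ B₁) = B₁ := symmDiff_symmDiff_cancel_left _ _
    have e₂ : A ∆ (A ∆ B₂) = B₂ := symmDiff_symmDiff_cancel_left _ _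
    -- the sign at `y` tells whether `q` belongs to the sign change
    have hqiff : ∀ b ≤ V₀ ⊓ V₁, (q ∈ b ↔ ¬ (y ∈ hF.gam A ↔ y ∈ hF.gam (A ∆ b))) := by
      intro b hb
      by_cases hqb : q ∈ b
      · have := hdep b (hb.trans inf_le_left) V₀ le_rfl ⟨fun _ => hqV₀, fun _ => hqb⟩
        tauto
      · have := hdep b (hb.trans inf_le_left) ⊥ bot_le ⟨fun h => (hqb h).elim, fun h => h.elim⟩
        rw [symmDiff_bot] at this
        tauto
    have h1 := hqiff _ hn₁
    have h2 := hqiff _ hn₂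
    rw [e₁] at h1
    rw [e₂] at h2
    have h3 := hdep₁ _ (hn₁.trans inf_le_right) _ (hn₂.trans inf_le_right)
      (by rw [h1, h2, hyc])
    rw [e₁, e₂] at h3
    exact hzc' h3
  have hwy : w y = 0 := hzero z₀ hz₀ ▸ hz₀
  have hopen : IsOpen {x | w x < 0} := isOpen_lt w.continuous continuous_const
  have hclosed : IsClosed {x | w x < 0} := by
    have : {x | w x < 0} = {x | w x ≤ 0} \ {y} := by
      ext x
      constructor
      · intro hx
        refine ⟨le_of_lt (show w x < 0 from hx), ?_⟩
        rintro rfl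
        exact absurd hx (by simp [hwy])
      · rintro ⟨hx, hxy⟩
        exact lt_of_le_of_ne hx fun h => hxy (hzero x h)
    rw [this]
    exact (isClosed_le w.continuous continuous_const).sdiff hy
  let C : Clopens K := ⟨{x | w x < 0}, hclosed, hopen⟩
  have hC : ∀ x, -0 ≤ w x * sg C x := fun x => by
    by_cases hx : w x < 0
    · rw [sg_of_mem (show x ∈ C from hx)]
      linarith
    · rw [sg_of_notMem (show x ∉ C from hx)]
      linarith
  have hC' : ∀ x, -0 ≤ w x * sg (C ∆ isolatedPoint y hy) x :=
    neg_le_mul_sg_symmDiff hC fun x hx => by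
      rw [mem_isolatedPoint.1 hx, hwy, abs_zero]
  -- only `sg A` is compatible with `F w`, as two clopen sets cannot differ just at `q`
  have hone : ∀ B, (∀ x, -0 ≤ w x * sg (hF.gam B) x) → B = A := by
    intro B hB
    by_contra hne
    have hsub : ∀ x ∈ A ∆ B, x = q := fun x hx => by
      by_contra hxq
      have h := hF.le_mul_sg_of_gam B hw hB x
      rw [hwv, hv] at h
      exact mem_symmDiff_clopens.1 hx (mem_iff_of_neg_lt_sg_mul_sg h (hpne x hxq))
    refine hq ?_
    have : ({q} : Set K) = (A ∆ B : Clopens K) := by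
      refine (Set.Subset.antisymm (fun x hx => hsub x hx) ?_).symm
      rintro x rfl
      by_contra hx
      refine hne (symmDiff_eq_bot.1 (Clopens.ext (eq_empty_of_forall_notMem fun x' hx' => ?_))).symm
      exact hx (hsub x' hx' ▸ hx')
    rw [this]
    exact Clopens.isOpen _
  obtain ⟨B₁, hB₁⟩ := hs C
  obtain ⟨B₂, hB₂⟩ := hs (C ∆ isolatedPoint y hy)
  have h1 := hone B₁ (by rw [hB₁]; exact hC)
  have h2 := hone B₂ (by rw [hB₂]; exact hC')
  rw [h1] at hB₁
  rw [h2, hB₁, eq_comm, symmDiff_eq_left] at hB₂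
  exact clopens_ne_bot_of_mem (mem_isolatedPoint.2 rfl) hB₂

/-- Small clopen neighbourhoods of a non-isolated point `q` may be removed from a sign change
without affecting a given isolated point. -/
theorem exists_mem_flip_sdiff_iff (hF : NonexpansiveBallBijection F)
    (hs : Function.Surjective hF.gam) (hq : ¬ IsOpen ({q} : Set K)) (hqU : q ∈ U)
    (hU : ∀ V ≤ U, q ∉ V → hF.Additive V) (A : Clopens K) {b : Clopens K} (hb : b ≤ U)
    (hqb : q ∈ b) (y : K) (hy : IsOpen ({y} : Set K)) :
    ∃ V₁, q ∈ V₁ ∧ ∀ V ≤ V₁, q ∈ V → (y ∈ hF.flip A b ↔ y ∈ hF.flip A (b \ V)) := by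
  obtain ⟨V₁, hV₁, hqV₁, h₁⟩ := hF.exists_notMem_flip hs hq hqU hU A y hy
  refine ⟨V₁ ⊓ b, ⟨hqV₁, hqb⟩, fun V hV hqV => ?_⟩
  obtain ⟨V₂, hV₂, hqV₂, h₂⟩ := hF.exists_notMem_flip hs hq hqU hU (A ∆ (b \ V)) y hy
  have hVb : V ≤ b := hV.trans inf_le_right
  have hVV₁ : V ≤ V₁ := hV.trans inf_le_left
  have hqW : q ∈ V₂ ⊓ V := ⟨hqV₂, hqV⟩
  have e₁ : b = V ∆ (b \ V) := by
    refine SetLike.ext fun x => ?_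
    simp only [mem_symmDiff_clopens, mem_sdiff_clopens]
    have : x ∈ V → x ∈ b := fun h => hVb h
    tauto
  have e₂ : (A ∆ (V₂ ⊓ V)) ∆ (V \ (V₂ ⊓ V)) = A ∆ V := by
    refine SetLike.ext fun x => ?_
    simp only [mem_symmDiff_clopens, mem_sdiff_clopens, mem_inf_clopens]
    tauto
  have h3 := (hU ((V \ (V₂ ⊓ V)) ⊔ (b \ V))
    (sup_le (sdiff_le.trans (hVb.trans hb)) (sdiff_le.trans hb))
    (fun h => h.elim (fun h => h.2 hqW) fun h => h.2 hqV) (A ∆ (V₂ ⊓ V)) (V \ (V₂ ⊓ V)) (b \ V)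
    le_sup_left le_sup_right (disjoint_sdiff_self_right.mono_left sdiff_le)).1
  rw [e₂] at h3
  have h4 := h₁ V hVV₁ hqV
  have h5 := h₁ (V₂ ⊓ V) (inf_le_right.trans hVV₁) hqW
  have h6 := h₂ (V₂ ⊓ V) inf_le_left hqW
  have h7 := hF.flip_comm A (b \ V) (V₂ ⊓ V) y
  have h8 := hF.mem_flip_symmDiff (A := A) (b := V) (c := b \ V) (y := y)
  rw [← e₁, h3] at h8
  clear h3 h₁ h₂
  grind

/-- Additivity of `U` follows from additivity of the clopen subsets of `U` missing one non-isolated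
point, since isolated points are dense and can be treated separately. -/
theorem additive_of_notMem (hF : NonexpansiveBallBijection F)
    (hs : Function.Surjective hF.gam) (hq : ¬ IsOpen ({q} : Set K)) (hqU : q ∈ U)
    (hU : ∀ V ≤ U, q ∉ V → hF.Additive V) : hF.Additive U := by
  have main : ∀ A b c, b ≤ U → c ≤ U → Disjoint b c → q ∈ c →
      hF.flip (A ∆ b) c = hF.flip A c ∧ Disjoint (hF.flip A b) (hF.flip A c) := by
    intro A b c hb hc hbc hqc
    have hqb : q ∉ b := fun h => clopens_disjoint_iff.1 hbc q h hqc
    have hadd : ∀ V, q ∈ V →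
        hF.flip (A ∆ b) (c \ V) = hF.flip A (c \ V) ∧
          Disjoint (hF.flip A b) (hF.flip A (c \ V)) := fun V hqV =>
      hU (b ⊔ (c \ V)) (sup_le hb (sdiff_le.trans hc)) (fun h => h.elim hqb fun h => h.2 hqV)
        A b (c \ V) le_sup_left le_sup_right (hbc.mono_right sdiff_le)
    constructor
    · refine clopens_ext_isolated fun y hy => ?_
      obtain ⟨V₁, hq₁, h₁⟩ := hF.exists_mem_flip_sdiff_iff hs hq hqU hU A hc hqc y hy
      obtain ⟨V₂, hq₂, h₂⟩ := hF.exists_mem_flip_sdiff_iff hs hq hqU hU (A ∆ b) hc hqc y hy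
      rw [h₁ (V₁ ⊓ V₂) inf_le_left ⟨hq₁, hq₂⟩, h₂ (V₁ ⊓ V₂) inf_le_right ⟨hq₁, hq₂⟩,
        (hadd (V₁ ⊓ V₂) ⟨hq₁, hq₂⟩).1]
    · rw [disjoint_iff]
      by_contra hne
      obtain ⟨y, ⟨hyb, hyc⟩, hy⟩ := exists_isOpen_singleton_mem hne
      obtain ⟨V₁, hq₁, h₁⟩ := hF.exists_mem_flip_sdiff_iff hs hq hqU hU A hc hqc y hy
      exact clopens_disjoint_iff.1 (hadd V₁ hq₁).2 y hyb ((h₁ V₁ le_rfl hq₁).1 hyc)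
  intro A b c hb hc hbc
  by_cases hqc : q ∈ c
  · exact main A b c hb hc hbc hqc
  by_cases hqb : q ∈ b
  · obtain ⟨h1, h2⟩ := main A c b hc hb hbc.symm hqb
    refine ⟨?_, h2.symm⟩
    have h := hF.flip_symmDiff A b c
    rw [symmDiff_comm b c, hF.flip_symmDiff A c b, h1, symmDiff_comm] at h
    exact (symmDiff_right_injective _ h).symm
  · exact hU (b ⊔ c) (sup_le hb hc) (fun h => h.elim hqb hqc) A b c le_sup_left le_sup_right hbc

theorem additive_top (hF : NonexpansiveBallBijection F) (hs : Function.Surjective hF.gam) :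
    hF.Additive ⊤ := by
  have hL : IsClosed {x : K | ¬ IsOpen ({x} : Set K)} := by
    rw [← isOpen_compl_iff, isOpen_iff_mem_nhds]
    intro x hx
    have hx' : IsOpen ({x} : Set K) := not_not.1 hx
    refine Filter.mem_of_superset (hx'.mem_nhds rfl) ?_
    rintro y rfl
    exact hx
  refine clopens_scattered_induction hL (fun U hU => hF.additive_of_isolated hs fun x hx => ?_)
    (fun q hq U hqU hU => hF.additive_of_notMem hs hq hqU hU) ⊤
  by_contra h
  exact disjoint_left.1 hU hx h

/-- By additivity, the clopen sets `b` with `y ∈ flip ⊥ b` form an ultrafilter. It converges by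
compactness, and its limit is `π y`. -/
theorem exists_isPointMap_of_surjective (hF : NonexpansiveBallBijection F)
    (hs : Function.Surjective hF.gam) : ∃ π, hF.IsPointMap π := by
  refine hF.exists_isPointMap fun y => ?_
  have hadd := hF.additive_top hs
  have hflip : ∀ b, hF.gam ⊥ ∆ hF.gam b = hF.flip ⊥ b := fun b => by rw [flip, bot_symmDiff]
  simp only [hflip]
  have hsup : ∀ b c, y ∉ hF.flip ⊥ b → y ∉ hF.flip ⊥ c → y ∉ hF.flip ⊥ (b ⊔ c) := by
    intro b c hb hc hbc
    have e₁ : b ⊔ c = b ∆ (c \ b) := by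
      refine SetLike.ext fun x => ?_
      simp only [mem_symmDiff_clopens, mem_sdiff_clopens, mem_sup_clopens]
      tauto
    have e₂ : c = (c ⊓ b) ∆ (c \ b) := by
      refine SetLike.ext fun x => ?_
      simp only [mem_symmDiff_clopens, mem_sdiff_clopens, mem_inf_clopens]
      tauto
    have h1 := hadd ⊥ b (c \ b) le_top le_top disjoint_sdiff_self_right
    have h2 := hadd ⊥ (c ⊓ b) (c \ b) le_top le_top
      (disjoint_sdiff_self_right.mono_left inf_le_right)
    rw [e₁, mem_flip_symmDiff, h1.1] at hbc
    rw [e₂, mem_flip_symmDiff, h2.1] at hc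
    have h3 := clopens_disjoint_iff.1 h2.2 y
    tauto
  by_contra! h
  choose b hxb hyb using h
  obtain ⟨t, ht⟩ := CompactSpace.elim_nhds_subcover (fun x => (b x : Set K))
    (fun x => (b x).isOpen.mem_nhds (hxb x))
  have hall : ∀ s : Finset K, y ∉ hF.flip ⊥ (s.sup b) := by
    classical
    intro s
    induction s using Finset.induction_on with
    | empty =>
      rw [Finset.sup_empty, flip, symmDiff_bot, symmDiff_self]
      exact fun h => h
    | insert a s _ ih =>
      rw [Finset.sup_insert]
      exact hsup _ _ (hyb a) ih
  have htop : t.sup b = ⊤ := by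
    apply Clopens.ext
    rw [Clopens.coe_finset_sup]
    exact ht
  have := hall t
  rw [htop, mem_flip, bot_symmDiff, ← compl_bot, hF.gam_compl] at this
  have h' : y ∈ (hF.gam ⊥)ᶜ ↔ y ∉ hF.gam ⊥ := Iff.rfl
  tauto

omit [Countable K] in
theorem IsPointMap.injective_of_surjective [TotallyDisconnectedSpace K]
    {hF : NonexpansiveBallBijection F} {π : K → K}
    (hπ : hF.IsPointMap π) (hs : Function.Surjective hF.gam) : Function.Injective π := by
  intro y₁ y₂ hy
  by_contra hne
  obtain ⟨N, hyN, hN⟩ := exists_clopens_mem_subset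
    (isOpen_compl_singleton : IsOpen ({y₂}ᶜ : Set K)) (x := y₁) hne
  obtain ⟨b, hb⟩ := hs (hF.gam ⊥ ∆ N)
  have h₁ := hπ b y₁
  have h₂ := hπ b y₂
  rw [hb, symmDiff_symmDiff_cancel_left] at h₁ h₂
  exact hN (h₂.2 (hy ▸ h₁.1 hyN)) rfl

end NonexpansiveBallBijection

end AdditiveStep

/-! ### Extreme points of the unit ball -/

section ExtremePoints

variable {K : Type*} [TopologicalSpace K] [CompactSpace K]

theorem sg_mem_extremePoints (A : Clopens K) :
    sg A ∈ extremePoints ℝ (Metric.closedBall (0 : C(K, ℝ)) 1) := by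
  rw [mem_extremePoints]
  refine ⟨mem_closedBall_zero_iff.2 (norm_sg_le A), fun f hf g hg h => ?_⟩
  rw [mem_closedBall_zero_iff, norm_le_one_iff] at hf hg
  obtain ⟨a, b, ha, hb, hab, hfg⟩ := h
  have key : ∀ x, f x = sg A x ∧ g x = sg A x := fun x => by
    have h1 : a * f x + b * g x = sg A x := DFunLike.congr_fun hfg x
    have h2 := abs_le.1 (hf x)
    have h3 := abs_le.1 (hg x)
    rcases sg_eq_or A x with h4 | h4 <;> rw [h4] at h1 ⊢ <;>
      constructor <;> nlinarith [h2.1, h2.2, h3.1, h3.2]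
  exact ⟨ContinuousMap.ext fun x => (key x).1, ContinuousMap.ext fun x => (key x).2⟩

theorem exists_eq_sg_of_mem_extremePoints {f : C(K, ℝ)}
    (hf : f ∈ extremePoints ℝ (Metric.closedBall (0 : C(K, ℝ)) 1)) :
    ∃ A : Clopens K, f = sg A := by
  refine exists_eq_sg fun x => ?_
  rw [mem_extremePoints] at hf
  obtain ⟨hf1, hext⟩ := hf
  rw [mem_closedBall_zero_iff, norm_le_one_iff] at hf1
  -- `f` is the midpoint of `f + d` and `f - d`
  let d : C(K, ℝ) := ⟨fun x => 1 - |f x|, by fun_prop⟩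
  have hd : ∀ x, d x = 1 - |f x| := fun _ => rfl
  have hplus : f + d ∈ Metric.closedBall (0 : C(K, ℝ)) 1 := by
    rw [mem_closedBall_zero_iff, norm_le_one_iff]
    intro y
    rw [ContinuousMap.add_apply, hd, abs_le]
    constructor <;> linarith [neg_abs_le (f y), le_abs_self (f y), hf1 y]
  have hminus : f - d ∈ Metric.closedBall (0 : C(K, ℝ)) 1 := by
    rw [mem_closedBall_zero_iff, norm_le_one_iff]
    intro y
    rw [ContinuousMap.sub_apply, hd, abs_le]
    constructor <;> linarith [neg_abs_le (f y), le_abs_self (f y), hf1 y]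
  have h := (hext _ hplus _ hminus ⟨1 / 2, 1 / 2, by norm_num, by norm_num, by norm_num, by
    ext y
    simp only [ContinuousMap.add_apply, ContinuousMap.smul_apply, ContinuousMap.sub_apply,
      smul_eq_mul]
    ring⟩).1
  have hx : f x + d x = f x := DFunLike.congr_fun h x
  rw [hd] at hx
  linarith

end ExtremePoints

end

/-! ### Isometry of non-expansive bijections -/

theorem corollary5p2 {K : Type*} [TopologicalSpace K] [CompactSpace K] [T2Space K] [Countable K]
    (F : UnitBallC K → UnitBallC K)
    (hbij : Function.Bijective F)
    (hF : LipschitzWith 1 F)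
    (h : (∀ f : UnitBallC K,
            (f : C(K, ℝ)) ∈ Set.extremePoints ℝ (Metric.closedBall (0 : C(K, ℝ)) 1) →
            (F f : C(K, ℝ)) ∈ Set.extremePoints ℝ (Metric.closedBall (0 : C(K, ℝ)) 1)) ∨
         (1 / 2 : ℝ≥0∞) < ⨅ f : {f : UnitBallC K // ‖(f : C(K, ℝ))‖ = 1},
            ‖(F f.1 : C(K, ℝ))‖ₑ) :
    Isometry F := by
  classical
  have hmem : ∀ f : C(K, ℝ), ‖f‖ ≤ 1 ↔ f ∈ Metric.closedBall (0 : C(K, ℝ)) 1 := fun f =>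
    mem_closedBall_zero_iff.symm
  -- `F` extended to all of `C(K, ℝ)`, by the identity off the ball
  let G : C(K, ℝ) → C(K, ℝ) := fun f =>
    if hf : ‖f‖ ≤ 1 then (F ⟨f, (hmem f).1 hf⟩ : C(K, ℝ)) else f
  have hG : ∀ f (hf : ‖f‖ ≤ 1), G f = F ⟨f, (hmem f).1 hf⟩ := fun f hf => dif_pos hf
  have hGF : ∀ f : UnitBallC K, G f = F f := fun f => hG f ((hmem _).2 f.2)
  have hball : NonexpansiveBallBijection G :=
    { maps := fun f hf => by
        rw [hG f hf]
        exact (hmem _).2 (F _).2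
      lip := fun f g hf hg => by
        rw [hG f hf, hG g hg, ← dist_eq_norm, ← dist_eq_norm]
        have h := hF.dist_le_mul ⟨f, (hmem f).1 hf⟩ ⟨g, (hmem g).1 hg⟩
        rw [NNReal.coe_one, one_mul] at h
        exact h
      inj := fun f g hf hg hfg => by
        rw [hG f hf, hG g hg] at hfg
        exact congrArg Subtype.val (hbij.1 (Subtype.ext hfg))
      surj := fun g hg => by
        obtain ⟨f, hf⟩ := hbij.2 ⟨g, (hmem g).1 hg⟩
        refine ⟨f, (hmem _).2 f.2, ?_⟩
        rw [hGF, hf] }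
  obtain ⟨π, hπ, hinj⟩ : ∃ π, hball.IsPointMap π ∧ Function.Injective π := by
    rcases h with h | h
    · have hs : Function.Surjective hball.gam := fun B => by
        have hB := norm_sg_le B
        obtain ⟨A, hA⟩ := exists_eq_sg_of_mem_extremePoints
          (h ⟨sg B, (hmem _).1 hB⟩ (sg_mem_extremePoints B))
        refine ⟨A, sg_injective (hball.inj _ _ (norm_sg_le _) hB ?_)⟩
        rw [hball.map_sg_gam, hG _ hB, hA]
      obtain ⟨π, hπ⟩ := hball.exists_isPointMap_of_surjective hs
      exact ⟨π, hπ, hπ.injective_of_surjective hs⟩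
    · obtain ⟨c, hc, hc'⟩ := ENNReal.lt_iff_exists_nnreal_btwn.1 h
      have hc2 : (1 / 2 : ℝ) < c := by
        have h2 : ((1 / 2 : NNReal) : ℝ≥0∞) < c := by
          rw [ENNReal.coe_div two_ne_zero]
          exact hc
        exact_mod_cast ENNReal.coe_lt_coe.1 h2
      have hlarge : ∀ f : C(K, ℝ), ‖f‖ = 1 → (c : ℝ) < ‖G f‖ := fun f hf => by
        have h1 := hc'.trans_le (iInf_le _ ⟨⟨f, (hmem f).1 hf.le⟩, hf⟩)
        rw [hG f hf.le]
        rw [enorm_eq_nnnorm, ENNReal.coe_lt_coe] at h1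
        exact h1
      obtain ⟨π, hπ⟩ := hball.exists_isPointMap_of_lt_norm hlarge hc2.le
      exact ⟨π, hπ, hπ.injective_of_lt_norm hlarge hc2⟩
  refine Isometry.of_dist_eq fun f g => ?_
  rw [Subtype.dist_eq, Subtype.dist_eq, dist_eq_norm, dist_eq_norm, ← hGF, ← hGF]
  exact hπ.norm_map_sub hinj ((hmem _).2 f.2) ((hmem _).2 g.2)
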